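/- Let $U\subseteq\mathbb R^{d_1}$ and $V\subseteq\mathbb R^{d_2}$ be open, and let $$F(x,q)=\sum_{m\ge0}F^{i_1\dots i_m}(x)\,q_{i_1}\cdots q_{i_m},\qquad G(y,r)=\sum_{\ell\ge0}G^{a_1\dots a_\ell}(y)\,r_{a_1}\cdots r_{a_\ell}$$ be generating functions of classical thick morphisms $\Phi_F$, $\Phi_G$ in local coordinates: formal power series in the momenta $q_1,\dots,q_{d_2}$, respectively $r_1,\dots,r_{d_3}$, whose coefficients are symmetric in their indices and smooth on $U$, respectively $V$. Write $F_0$, $G_0$ for the coefficients of order zero and $\varphi^i(x)=F^i(x)$ for the linear ones, and assume $\varphi(U)\subseteq V$. The generating function of $\Phi_H=\Phi_G\circ\Phi_F$ is $$H(x,r)=G(\bar y,r)+F(x,\bar q)-\bar y^\alpha\bar q_\alpha,\qquad \bar q_\alpha=\frac{\partial G}{\partial y^\alpha}(\bar y,r),\quad \bar y^\alpha=\frac{\partial F}{\partial q_\alpha}(x,\bar q),$$ where $\bar q$ has no constant term and $G$ is evaluated at the formal series $\bar y$ by Taylor expansion. A bipartite tree $t$ has black vertices $B_t=\{1,\dots,|t|_\bullet\}$,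 white vertices $W_t=\{-1,\dots,-|t|_\circ\}$ and edges $E_t$ joining black to white vertices. It is white-leaved if no black vertex has degree one (so the single black vertex is allowed), and white-weighted if each $w\in W_t$ carries a weight $\ell_w\in\mathbb Z_{\ge0}$. Isomorphisms preserve colours, edges and weights, and $sym(t)$ is the automorphism group of $t$. Let $T^\circ_{\infty/2}$ be the set of white-weighted white-leaved bipartite trees and $[T^\circ]_{\infty/2}$ its set of isomorphism classes. Put $$r_{I_t}\langle F,G\rangle_t^{I_t}(x)=\Big(\prod_{v\in B_t}m_v!\,F^{e^v_1\dots e^v_{m_v}}(x)\Big)\prod_{w\in W_t}\Big(\frac{\partial}{\partial y^{e^w_1}}\cdots\frac{\partial}{\partial y^{e^w_{m_w}}}G^{a_{w,1}\dots a_{w,\ell_w}}\big(\varphi(x)\big)\,r_{a_{w,1}}\cdots r_{a_{w,\ell_w}}\Big),$$ where $e^v_1,\dots,e^v_{m_v}$ are the edges at the vertex $v$ (of either colour), and the edges, used as indices in $\{1,\dots,d_2\}$, and the indices $a_{w,k}\in\{1,\dots,d_3\}$ are summed over. Then, for every $x\in U$, the pair $(\bar y,\bar q)$ exists and is unique, and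 $$H(x,r)=\sum_{t\in T^\circ_{\infty/2}}\frac{r_{I_t}}{|t|_\circ!\,|t|_\bullet!}\langle F,G\rangle_t^{I_t}(x)=\sum_{t\in[T^\circ]_{\infty/2}}\frac{r_{I_t}}{|sym(t)|}\langle F,G\rangle_t^{I_t}(x).$$ Each of the sums is a sum of formal power series, with only finitely many nonzero contributions to each coefficient. The assertion is meant in each of the following two senses. 1. As functional power series in $G$: $G$ is replaced by $\varepsilon G$ with a formal variable $\varepsilon$ recording the order in $G$, all series are formal power series in $\varepsilon$ and $r$, and the term of $t$ acquires the factor $\varepsilon^{|t|_\circ}$. 2. As formal power series in $r$ alone, without $\varepsilon$, at every $x\in U$ at which the first and second derivatives of $G_0$ vanish at $\varphi(x)$. -/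

import Mathlib

open scoped ContDiff

noncomputable section

namespace ThickMorphism

/-! ### Formal series and their evaluation -/

/-- The formal power series `∑ₖ ∑_{a₁,…,aₖ} T^{a₁…aₖ} X_{a₁} ⋯ X_{aₖ}` with tensor coefficients
`T`. The coefficient of the monomial `X^n` collects all index tuples `a` of content `n`. -/
def tensorSeries {d : ℕ} (T : ∀ k : ℕ, (Fin k → Fin d) → ℝ) : MvPowerSeries (Fin d) ℝ :=
  fun n => ∑ a : Fin n.degree → Fin d with ∑ k, Finsupp.single (a k) 1 = n, T n.degree a

/-- The iterated partial derivative `∂/∂y^{a₁} ⋯ ∂/∂y^{aₖ} f` at `y`. -/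
def partials {d k : ℕ} (a : Fin k → Fin d) (f : (Fin d → ℝ) → ℝ) (y : Fin d → ℝ) : ℝ :=
  iteratedFDeriv ℝ k f y (fun j => Pi.single (a j) 1)

/-- The Taylor series `∑ₖ (1/k!) ∑_a ∂_{a₁}⋯∂_{aₖ} f(c) X_{a₁} ⋯ X_{aₖ}` of `f` at `c`. -/
def taylorSeries {d : ℕ} (f : (Fin d → ℝ) → ℝ) (c : Fin d → ℝ) : MvPowerSeries (Fin d) ℝ :=
  tensorSeries fun k a => ((k.factorial : ℝ))⁻¹ * partials a f c

/-- For a formal power series `g(y, r)` in `r` whose coefficients are functions of `y`: the series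
obtained by expanding each coefficient in its Taylor series at `y = c`.
The variables `Sum.inl i` stand for `y^i - c^i` and the variables `Sum.inr j` for `r_j`. -/
def jointTaylor {d n : ℕ} (g : (Fin d → ℝ) → MvPowerSeries (Fin n) ℝ) (c : Fin d → ℝ) :
    MvPowerSeries (Fin d ⊕ Fin n) ℝ :=
  fun N => MvPowerSeries.coeff (Finsupp.sumFinsuppEquivProdFinsupp N).1
    (taylorSeries (fun y => MvPowerSeries.coeff (Finsupp.sumFinsuppEquivProdFinsupp N).2 (g y)) c)

/-- `g(ȳ, ρ)` for formal power series `ȳ^i` and formal power series `ρ_j` without constant term: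
with `c` the constant term of `ȳ`, expand `g` at `y = c` by Taylor's formula and substitute the
series `ȳ - c`, which has no constant term. -/
def evalAt {τ : Type} {d n : ℕ} (g : (Fin d → ℝ) → MvPowerSeries (Fin n) ℝ)
    (ybar : Fin d → MvPowerSeries τ ℝ) (ρ : Fin n → MvPowerSeries τ ℝ) : MvPowerSeries τ ℝ :=
  MvPowerSeries.subst
    (Sum.elim
      (fun i => ybar i - MvPowerSeries.C (MvPowerSeries.constantCoeff (ybar i))) ρ)
    (jointTaylor g fun i => MvPowerSeries.constantCoeff (ybar i))

/-- `∂g/∂y^α`, coefficient by coefficient in `r`. -/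
def partialY {d n : ℕ} (α : Fin d) (g : (Fin d → ℝ) → MvPowerSeries (Fin n) ℝ) :
    (Fin d → ℝ) → MvPowerSeries (Fin n) ℝ :=
  fun y m => fderiv ℝ (fun y' => MvPowerSeries.coeff m (g y')) y (Pi.single α 1)

/-- `H = ∑ᵢ fᵢ` as a sum of formal power series: every coefficient receives contributions from
only finitely many `i`, and these add up to the coefficient of `H`. -/
def IsFormalSum {ι τ : Type} (f : ι → MvPowerSeries τ ℝ) (H : MvPowerSeries τ ℝ) : Prop :=
  ∀ n : τ →₀ ℕ, (Function.support fun i => MvPowerSeries.coeff n (f i)).Finite ∧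
    MvPowerSeries.coeff n H = ∑ᶠ i, MvPowerSeries.coeff n (f i)

/-! ### Generating functions of thick morphisms in local coordinates -/

/-- A generating function `F(x, q) = F⁰(x) + Fⁱ(x) qᵢ + Fⁱʲ(x) qᵢ qⱼ + ⋯` in coordinates `x` on
`U ⊆ ℝᵐ`: a formal power series in momenta `q₁, …, q_d` whose coefficients are smooth functions
on `U`, symmetric in their indices. -/
structure GeneratingFunction {m : ℕ} (U : Set (Fin m → ℝ)) (d : ℕ) where
  /-- `coeff k a` is the coefficient function `F^{a₁…aₖ}`. -/
  coeff : ∀ k : ℕ, (Fin k → Fin d) → (Fin m → ℝ) → ℝ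
  smooth : ∀ k a, ContDiffOn ℝ ∞ (coeff k a) U
  symm : ∀ k (σ : Equiv.Perm (Fin k)) a, coeff k (a ∘ σ) = coeff k a

namespace GeneratingFunction

variable {m d : ℕ} {U : Set (Fin m → ℝ)}

/-- `F(x, ·)` as a formal power series in the momenta. -/
def series (F : GeneratingFunction U d) (x : Fin m → ℝ) : MvPowerSeries (Fin d) ℝ :=
  tensorSeries fun k a => F.coeff k a x

/-- The coefficient `F⁰(x)` of order zero in the momenta. -/
def zeroth (F : GeneratingFunction U d) (x : Fin m → ℝ) : ℝ :=
  F.coeff 0 Fin.elim0 x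

/-- The vector `φ(x)` of coefficients of the terms linear in the momenta. -/
def phi (F : GeneratingFunction U d) (x : Fin m → ℝ) : Fin d → ℝ :=
  fun i => F.coeff 1 (fun _ => i) x

end GeneratingFunction

/-! ### The composition law

The momenta `r` and the overall factor of `G` are given by formal power series
`ρ_j` and `s` in some set `τ` of formal variables, so that `G` is replaced by `s • G(y, ρ)`. -/

section Composition

variable {d₁ d₂ d₃ : ℕ} {U : Set (Fin d₁ → ℝ)} {V : Set (Fin d₂ → ℝ)} {τ : Type}

/-- `ȳ`, `q̄` are formal power series, `q̄` without constant term, that solve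
`q̄_α = ∂(s G)/∂y^α (ȳ, ρ)` and `ȳ^α = ∂F/∂q_α (x, q̄)`. -/
structure IsSolution (F : GeneratingFunction U d₂) (G : GeneratingFunction V d₃)
    (s : MvPowerSeries τ ℝ) (ρ : Fin d₃ → MvPowerSeries τ ℝ) (x : Fin d₁ → ℝ)
    (ybar qbar : Fin d₂ → MvPowerSeries τ ℝ) : Prop where
  constantCoeff_qbar : ∀ α, MvPowerSeries.constantCoeff (qbar α) = 0
  qbar_eq : ∀ α, qbar α = s * evalAt (partialY α G.series) ybar ρ
  ybar_eq : ∀ α, ybar α = MvPowerSeries.subst qbar (MvPowerSeries.pderiv ℝ α (F.series x))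

/-- `s G(ȳ, ρ) + F(x, q̄) - ȳ^α q̄_α`. -/
def compositionValue (F : GeneratingFunction U d₂) (G : GeneratingFunction V d₃)
    (s : MvPowerSeries τ ℝ) (ρ : Fin d₃ → MvPowerSeries τ ℝ) (x : Fin d₁ → ℝ)
    (ybar qbar : Fin d₂ → MvPowerSeries τ ℝ) : MvPowerSeries τ ℝ :=
  s * evalAt G.series ybar ρ + MvPowerSeries.subst qbar (F.series x) - ∑ α, ybar α * qbar α

end Composition

/-! ### White-weighted white-leaved bipartite trees -/

/-- The simple graph with black vertices `Fin b`, white vertices `Fin w` and edge set `E`. -/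
def bipartiteGraph {b w : ℕ} (E : Finset (Fin b × Fin w)) : SimpleGraph (Fin b ⊕ Fin w) :=
  SimpleGraph.fromRel fun u v => ∃ e ∈ E, u = Sum.inl e.1 ∧ v = Sum.inr e.2

/-- A (labelled) white-weighted bipartite tree all of whose leaves are white. A leaf is a vertex of
degree one, so the tree consisting of a single black vertex is allowed. Since a double edge would
be a cycle, the edges form a set. -/
structure WTree where
  /-- the number of black vertices -/
  numBlack : ℕ
  /-- the number of white vertices -/
  numWhite : ℕ
  edges : Finset (Fin numBlack × Fin numWhite)
  isTree : (bipartiteGraph edges).IsTree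
  whiteLeaved : ∀ v : Fin numBlack, (edges.filter fun e => e.1 = v).card ≠ 1
  weight : Fin numWhite → ℕ

namespace WTree

/-- An isomorphism of white-weighted bipartite trees. -/
structure Iso (t t' : WTree) where
  black : Fin t.numBlack ≃ Fin t'.numBlack
  white : Fin t.numWhite ≃ Fin t'.numWhite
  map_edges : ∀ v w, (black v, white w) ∈ t'.edges ↔ (v, w) ∈ t.edges
  map_weight : ∀ w, t'.weight (white w) = t.weight w

/-- The number of automorphisms of `t`. -/
def symCard (t : WTree) : ℕ := Nat.card (Iso t t)

instance isoSetoid : Setoid WTree where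
  r t t' := Nonempty (Iso t t')
  iseqv :=
    { refl := fun _ => ⟨⟨Equiv.refl _, Equiv.refl _, fun _ _ => Iff.rfl, fun _ => rfl⟩⟩
      symm := fun ⟨f⟩ => ⟨⟨f.black.symm, f.white.symm,
        fun v w => by simpa using (f.map_edges (f.black.symm v) (f.white.symm w)).symm,
        fun w => by simpa using (f.map_weight (f.white.symm w)).symm⟩⟩
      trans := fun ⟨f⟩ ⟨g⟩ => ⟨⟨f.black.trans g.black, f.white.trans g.white,
        fun v w => (g.map_edges _ _).trans (f.map_edges v w),
        fun w => (g.map_weight _).trans (f.map_weight w)⟩⟩ }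

/-- Isomorphism classes of white-weighted white-leaved bipartite trees. -/
abbrev IsoClass : Type := Quotient isoSetoid

/-- The set of edges at a black vertex. -/
def blackEdges (t : WTree) (v : Fin t.numBlack) : Finset t.edges :=
  Finset.univ.filter fun e => e.1.1 = v

/-- The set of edges at a white vertex. -/
def whiteEdges (t : WTree) (w : Fin t.numWhite) : Finset t.edges :=
  Finset.univ.filter fun e => e.1.2 = w

/-- An enumeration `e₁, …, eₘ` of a finite set of edges. -/
def enum {t : WTree} (s : Finset t.edges) (k : Fin s.card) : t.edges :=
  (s.equivFin.symm k).1

variable {d₁ d₂ d₃ : ℕ} {U : Set (Fin d₁ → ℝ)} {V : Set (Fin d₂ → ℝ)}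

/-- The tensor `⟨F, G⟩_t^{I_t}(x)`; the multi-index `I_t` consists of indices `a w k`, one for each
white vertex `w` and each `k < weight w`. Each edge carries a dummy index `ι e`, summed over. -/
def contraction (F : GeneratingFunction U d₂) (G : GeneratingFunction V d₃) (t : WTree)
    (x : Fin d₁ → ℝ) (a : ∀ w : Fin t.numWhite, Fin (t.weight w) → Fin d₃) : ℝ :=
  ∑ ι : t.edges → Fin d₂,
    (∏ v : Fin t.numBlack, ((t.blackEdges v).card.factorial : ℝ) *
      F.coeff (t.blackEdges v).card (fun k => ι (enum (t.blackEdges v) k)) x) *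
    (∏ w : Fin t.numWhite,
      partials (fun k => ι (enum (t.whiteEdges w) k)) (G.coeff (t.weight w) (a w)) (F.phi x))

/-- `s^{|t|_∘} ρ_{I_t} ⟨F, G⟩_t^{I_t}(x)`, with the indices in `I_t` summed over. -/
def term {τ : Type} (F : GeneratingFunction U d₂) (G : GeneratingFunction V d₃)
    (s : MvPowerSeries τ ℝ) (ρ : Fin d₃ → MvPowerSeries τ ℝ) (x : Fin d₁ → ℝ) (t : WTree) :
    MvPowerSeries τ ℝ :=
  s ^ t.numWhite * ∑ a : ∀ w : Fin t.numWhite, Fin (t.weight w) → Fin d₃,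
    (t.contraction F G x a) • ∏ w, ∏ k, ρ (a w k)

end WTree

/-- `ȳ`, `q̄` exist and are unique, and `H = s G(ȳ, ρ) + F(x, q̄) - ȳ^α q̄_α` is given by the tree
expansion, both as a sum over labelled trees and as a sum over isomorphism classes, for every choice
`rep` of representatives. -/
def HasTreeExpansion {d₁ d₂ d₃ : ℕ} {U : Set (Fin d₁ → ℝ)} {V : Set (Fin d₂ → ℝ)} {τ : Type}
    (F : GeneratingFunction U d₂) (G : GeneratingFunction V d₃)
    (s : MvPowerSeries τ ℝ) (ρ : Fin d₃ → MvPowerSeries τ ℝ) (x : Fin d₁ → ℝ) : Prop :=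
  ∃ ybar qbar : Fin d₂ → MvPowerSeries τ ℝ,
    IsSolution F G s ρ x ybar qbar ∧
    (∀ ybar' qbar', IsSolution F G s ρ x ybar' qbar' → ybar' = ybar ∧ qbar' = qbar) ∧
    IsFormalSum
      (fun t : WTree => ((t.numWhite.factorial : ℝ) * (t.numBlack.factorial : ℝ))⁻¹ •
        t.term F G s ρ x)
      (compositionValue F G s ρ x ybar qbar) ∧
    ∀ rep : WTree.IsoClass → WTree, (∀ c, Quotient.mk WTree.isoSetoid (rep c) = c) →
      IsFormalSum
        (fun c : WTree.IsoClass => ((rep c).symCard : ℝ)⁻¹ • (rep c).term F G s ρ x)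
        (compositionValue F G s ρ x ybar qbar)

end ThickMorphism

end

noncomputable section

namespace ThickMorphism

/-! ### Edge-coloured bipartite trees as matrices -/

section Matrices

variable {d : ℕ}

/-! Write `ȳ = φ(x) + η`, let `f` be `F(x, ·)` without its linear terms and let `g(η) = s G(φ(x) +
η, ρ)`. The linear terms of `F` only fix the point at which `G` is expanded: the equations become `η
= ∂f(q)`, `q = ∂g(η)`, and `H` is the critical value `f(q) + g(η) - η q`. Black leaves carry the
linear coefficients of `f`, which vanish, so a sum over all bipartite trees with black factors from
`f` is a sum over white-leaved ones.

The core is that for Taylor coefficients `β` (black) and `γ` (white) the sum over all bipartite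
trees, divided by `b! w!`, is this critical value. It rests on an invariance, `treeTotal_translate`:
the sum does not change when `β` is translated by `a` and the linear function `a` is subtracted from
`γ`. Along the path `t a` the derivative of the sum attaches a leg contracted with `a` to a black
vertex and, with a minus sign, replaces the factor of a white leaf by `a`; deleting that leaf
identifies the two kinds of terms (`leafSum_succ`). Translate `β` by `q` and then, with the colours
exchanged, `γ` by `η`. By the critical point equations all linear coefficients are now zero. Every
tree with an edge has a leaf, so only the two one-vertex trees survive, and they give the critical
value (`treeTotal_eq_critical_value`).

All this is done modulo series of order `N`, where the ideal of series without constant term is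
nilpotent. White vertices of degree one or two have factors of positive order: through `ε` in the
first sense; in the second because the first two derivatives of `G₀` vanish and a positive weight
brings a factor `r`. A count of edges then shows that big trees have high order
(`IsTreeMatrix.prod_mem_of_white`). The same alternative makes the equation for `q̄` a contraction
(`exists_solution`). Isomorphism classes are reached by orbit counting (`card_class_mul_symCard`).
-/

/-- The multi-index of an optional edge index. -/
def idx (o : Option (Fin d)) : Fin d →₀ ℕ := o.elim 0 fun i => Finsupp.single i 1

@[simp] lemma idx_none : idx (none : Option (Fin d)) = 0 := rfl

@[simp] lemma idx_some (i : Fin d) : idx (some i) = Finsupp.single i 1 := rfl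

lemma degree_idx (o : Option (Fin d)) : (idx o).degree = if o = none then 0 else 1 := by
  cases o <;> simp

/-- The edge set of a matrix `L`, in which `L u v = some i` stands for an edge with index `i`
between the white vertex `u` and the black vertex `v`. -/
def edgeSet {b w : ℕ} (L : Fin w → Fin b → Option (Fin d)) : Finset (Fin b × Fin w) :=
  Finset.univ.filter fun e => L e.2 e.1 ≠ none

@[simp] lemma mem_edgeSet {b w : ℕ} {L : Fin w → Fin b → Option (Fin d)} {e : Fin b × Fin w} :
    e ∈ edgeSet L ↔ L e.2 e.1 ≠ none := by
  simp [edgeSet]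

lemma card_edgeSet {b w : ℕ} (L : Fin w → Fin b → Option (Fin d)) :
    (edgeSet L).card = ∑ u, ∑ v, (idx (L u v)).degree := by
  simp only [edgeSet, Finset.card_filter, degree_idx]
  rw [Fintype.sum_prod_type, Finset.sum_comm]
  refine Finset.sum_congr rfl fun u _ => Finset.sum_congr rfl fun v _ => ?_
  by_cases h : L u v = none <;> simp [h]

@[simp] lemma bipartiteGraph_adj_inl_inr {b w : ℕ} {E : Finset (Fin b × Fin w)} {v : Fin b}
    {u : Fin w} : (bipartiteGraph E).Adj (Sum.inl v) (Sum.inr u) ↔ (v, u) ∈ E := by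
  simp [bipartiteGraph, SimpleGraph.fromRel_adj]

@[simp] lemma bipartiteGraph_adj_inr_inl {b w : ℕ} {E : Finset (Fin b × Fin w)} {v : Fin b}
    {u : Fin w} : (bipartiteGraph E).Adj (Sum.inr u) (Sum.inl v) ↔ (v, u) ∈ E := by
  rw [SimpleGraph.adj_comm, bipartiteGraph_adj_inl_inr]

@[simp] lemma bipartiteGraph_not_adj_inl_inl {b w : ℕ} {E : Finset (Fin b × Fin w)}
    {v v' : Fin b} : ¬ (bipartiteGraph E).Adj (Sum.inl v) (Sum.inl v') := by
  simp [bipartiteGraph, SimpleGraph.fromRel_adj]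

@[simp] lemma bipartiteGraph_not_adj_inr_inr {b w : ℕ} {E : Finset (Fin b × Fin w)}
    {u u' : Fin w} : ¬ (bipartiteGraph E).Adj (Sum.inr u) (Sum.inr u') := by
  simp [bipartiteGraph, SimpleGraph.fromRel_adj]

lemma card_edgeFinset_bipartiteGraph {b w : ℕ} (E : Finset (Fin b × Fin w)) :
    Nat.card (bipartiteGraph E).edgeSet = E.card := by
  classical
  have h : (bipartiteGraph E).edgeSet =
      ((fun e : Fin b × Fin w => s(Sum.inl e.1, Sum.inr e.2)) '' (E : Set (Fin b × Fin w))) := by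
    ext z
    induction z with
    | _ p q =>
      rcases p with p | p <;> rcases q with q | q <;>
        simp
  rw [h, Nat.card_coe_set_eq, Set.ncard_image_of_injective, Set.ncard_coe_finset]
  rintro ⟨a, b⟩ ⟨a', b'⟩ h
  simpa [Sym2.eq_iff] using h

lemma isTree_bipartiteGraph_iff {b w : ℕ} (E : Finset (Fin b × Fin w)) :
    (bipartiteGraph E).IsTree ↔ (bipartiteGraph E).Connected ∧ E.card + 1 = b + w := by
  rw [SimpleGraph.isTree_iff_connected_and_card, card_edgeFinset_bipartiteGraph]
  simp

/-- The matrix `L` describes a tree. -/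
def IsTreeMatrix {b w : ℕ} (L : Fin w → Fin b → Option (Fin d)) : Prop :=
  (bipartiteGraph (edgeSet L)).IsTree

lemma isTreeMatrix_flip {b w : ℕ} (L : Fin w → Fin b → Option (Fin d)) :
    IsTreeMatrix (flip L) ↔ IsTreeMatrix L := by
  let e : bipartiteGraph (edgeSet (flip L)) ≃g bipartiteGraph (edgeSet L) :=
    { toEquiv := Equiv.sumComm _ _
      map_rel_iff' := by
        rintro (a | a) (c | c) <;> simp [flip] }
  exact e.isTree_iff

/-- Add to `L` a white leaf `u`, joined to the black vertex `v` by an edge with index `i`. -/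
def addLeaf {b w : ℕ} (L : Fin w → Fin b → Option (Fin d)) (u : Fin (w + 1)) (v : Fin b)
    (i : Fin d) : Fin (w + 1) → Fin b → Option (Fin d) :=
  u.insertNth (α := fun _ => Fin b → Option (Fin d)) (Function.update (fun _ => none) v (some i)) L

@[simp] lemma addLeaf_same {b w : ℕ} (L : Fin w → Fin b → Option (Fin d)) (u : Fin (w + 1))
    (v : Fin b) (i : Fin d) :
    addLeaf L u v i u = Function.update (fun _ => none) v (some i) := by
  simp [addLeaf]

@[simp] lemma addLeaf_succAbove {b w : ℕ} (L : Fin w → Fin b → Option (Fin d)) (u : Fin (w + 1))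
    (v : Fin b) (i : Fin d) (u' : Fin w) : addLeaf L u v i (u.succAbove u') = L u' := by
  simp [addLeaf]

lemma sum_idx_update {b : ℕ} (v : Fin b) (i : Fin d) :
    ∑ v', idx (Function.update (fun _ => none) v (some i) v') = Finsupp.single i 1 := by
  rw [Finset.sum_eq_single v]
  · simp
  · intro v' _ h
    simp [Function.update_of_ne h]
  · simp

/-- Collapsing the leaf onto its neighbour `v` is a retraction `r` onto the smaller graph. Both `r`
and the inclusion `j` preserve reachability, and every vertex can reach its image under `j ∘ r`. -/
lemma connected_addLeaf {b w : ℕ} (L : Fin w → Fin b → Option (Fin d)) (u : Fin (w + 1))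
    (v : Fin b) (i : Fin d) :
    (bipartiteGraph (edgeSet (addLeaf L u v i))).Connected ↔
      (bipartiteGraph (edgeSet L)).Connected := by
  set G := bipartiteGraph (edgeSet (addLeaf L u v i)) with hG
  set G' := bipartiteGraph (edgeSet L) with hG'
  let j : Fin b ⊕ Fin w → Fin b ⊕ Fin (w + 1) := Sum.map id u.succAbove
  let r : Fin b ⊕ Fin (w + 1) → Fin b ⊕ Fin w :=
    Sum.elim Sum.inl (u.insertNth (α := fun _ => Fin b ⊕ Fin w) (Sum.inl v) Sum.inr)
  have hrj : ∀ p, r (j p) = p := by rintro (p | p) <;> simp [r, j]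
  have hj : ∀ p q, G'.Adj p q → G.Adj (j p) (j q) := by
    rintro (p | p) (q | q) <;> simp [j, hG, hG']
  have hr1 : ∀ (p : Fin b) (q : Fin (w + 1)), G.Adj (Sum.inl p) (Sum.inr q) →
      G'.Reachable (r (Sum.inl p)) (r (Sum.inr q)) := by
    intro p q h
    induction q using Fin.succAboveCases u with
    | x =>
      have hp : p = v := by
        by_contra hne
        simp [hG, Function.update_of_ne hne] at h
      subst hp
      simp [r]
    | p q =>
      have : G'.Adj (Sum.inl p) (Sum.inr q) := by simpa [hG, hG'] using h
      simpa [r] using this.reachable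
  have hr : ∀ p q, G.Adj p q → G'.Reachable (r p) (r q) := by
    rintro (p | p) (q | q) h
    · simp [hG] at h
    · exact hr1 p q h
    · exact (hr1 q p h.symm).symm
    · simp [hG] at h
  have hrr : ∀ p q, G.Reachable p q → G'.Reachable (r p) (r q) := by
    rintro p q ⟨W⟩
    induction W with
    | nil => rfl
    | cons h _ ih => exact (hr _ _ h).trans ih
  have hjj : ∀ p q, G'.Reachable p q → G.Reachable (j p) (j q) := by
    rintro p q ⟨W⟩
    induction W with
    | nil => rfl
    | cons h _ ih => exact (hj _ _ h).reachable.trans ih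
  have hjr : ∀ p, G.Reachable p (j (r p)) := by
    rintro (p | p)
    · simp [r, j]
    · induction p using Fin.succAboveCases u with
      | x =>
        have : G.Adj (Sum.inr u) (Sum.inl v) := by simp [hG]
        simpa [r, j] using this.reachable
      | p q => simp [r, j]
  have : Nonempty (Fin b ⊕ Fin w) := ⟨Sum.inl v⟩
  have : Nonempty (Fin b ⊕ Fin (w + 1)) := ⟨Sum.inl v⟩
  simp only [SimpleGraph.connected_iff, SimpleGraph.Preconnected]
  refine and_congr ⟨fun h p q => ?_, fun h p q => ?_⟩ (iff_of_true ‹_› ‹_›)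
  · simpa [hrj] using hrr _ _ (h (j p) (j q))
  · exact (hjr p).trans ((hjj _ _ (h _ _)).trans (hjr q).symm)

/-- A leaf adds one vertex and one edge, so the criterion "connected, with one edge less than
vertices" is unaffected. -/
lemma isTreeMatrix_addLeaf {b w : ℕ} (L : Fin w → Fin b → Option (Fin d)) (u : Fin (w + 1))
    (v : Fin b) (i : Fin d) : IsTreeMatrix (addLeaf L u v i) ↔ IsTreeMatrix L := by
  rw [IsTreeMatrix, IsTreeMatrix, isTree_bipartiteGraph_iff, isTree_bipartiteGraph_iff,
    connected_addLeaf]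
  have h : (edgeSet (addLeaf L u v i)).card = (edgeSet L).card + 1 := by
    rw [card_edgeSet, card_edgeSet, Fin.sum_univ_succAbove _ u]
    simp only [addLeaf_same, addLeaf_succAbove]
    rw [← map_sum, sum_idx_update]
    simp [add_comm]
  rw [h]
  refine and_congr_right fun _ => ?_
  omega

/-- A row of a matrix with a single entry `i`. -/
lemma sum_idx_eq_single_iff {b : ℕ} (x : Fin b → Option (Fin d)) (i : Fin d) :
    ∑ v, idx (x v) = Finsupp.single i 1 ↔
      ∃ v, Function.update (fun _ => none) v (some i) = x := by
  constructor
  · intro h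
    have hd : ∑ v, (idx (x v)).degree = 1 := by
      rw [← map_sum, h]; simp
    have hex : ∃ v, x v ≠ none := by
      by_contra hcon
      push Not at hcon
      simp [hcon] at hd
    obtain ⟨v, hv⟩ := hex
    have h0 : ∀ v', v' ≠ v → x v' = none := by
      intro v' hne
      by_contra hv'
      have : ∑ v'' ∈ ({v, v'} : Finset (Fin b)), (idx (x v'')).degree ≤ 1 := by
        rw [← hd]
        exact Finset.sum_le_sum_of_subset (Finset.subset_univ _)
      rw [Finset.sum_pair hne.symm] at this
      simp [degree_idx, hv, hv'] at this
    refine ⟨v, ?_⟩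
    rw [Finset.sum_eq_single v (fun v' _ hne => by simp [h0 v' hne]) (by simp)] at h
    obtain ⟨k, hk⟩ := Option.ne_none_iff_exists'.1 hv
    rw [hk, idx_some] at h
    have hki : k = i := Finsupp.single_left_injective one_ne_zero h
    funext v'
    by_cases hne : v' = v
    · subst hne; simp [hk, hki]
    · simp [Function.update_of_ne hne, h0 v' hne]
  · rintro ⟨v, rfl⟩
    exact sum_idx_update v i

end Matrices

/-! ### Sums over trees and the removal of a leaf -/

section TreeSum

variable {d : ℕ} {S : Type*} [CommRing S]

open Classical in
/-- The sum over all trees with `b` black and `w` white vertices of the products of the vertex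
factors, `β μ` for a black and `γ μ` for a white vertex with edges of total multi-index `μ`. -/
def treeSum (β γ : (Fin d →₀ ℕ) → S) (b w : ℕ) : S :=
  ∑ L : Fin w → Fin b → Option (Fin d) with IsTreeMatrix L,
    (∏ v, β (∑ u, idx (L u v))) * ∏ u, γ (∑ v, idx (L u v))

open Classical in
/-- The sum over all trees in which one black vertex carries an additional leg, contracted
with `a`. -/
def markedSum (β γ : (Fin d →₀ ℕ) → S) (a : Fin d → S) (b w : ℕ) : S :=
  ∑ L : Fin w → Fin b → Option (Fin d) with IsTreeMatrix L, ∑ v₀, ∑ i, a i *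
    ((∏ v, β (∑ u, idx (L u v) + if v = v₀ then Finsupp.single i 1 else 0)) *
      ∏ u, γ (∑ v, idx (L u v)))

open Classical in
/-- The sum over all trees in which the factor of a marked white leaf is replaced by `a`. -/
def leafSum (β γ : (Fin d →₀ ℕ) → S) (a : Fin d → S) (b w : ℕ) : S :=
  ∑ L : Fin w → Fin b → Option (Fin d) with IsTreeMatrix L, ∑ u₀,
    (∑ i, if ∑ v, idx (L u₀ v) = Finsupp.single i 1 then a i else 0) *
    ((∏ v, β (∑ u, idx (L u v))) * ∏ u ∈ Finset.univ.erase u₀, γ (∑ v, idx (L u v)))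

lemma treeSum_swap (β γ : (Fin d →₀ ℕ) → S) (b w : ℕ) : treeSum β γ b w = treeSum γ β w b := by
  classical
  refine Finset.sum_equiv (Equiv.piComm _) (fun L => ?_) (fun L _ => ?_)
  · simp only [Finset.mem_filter, Finset.mem_univ, true_and]
    exact (isTreeMatrix_flip L).symm
  · rw [mul_comm]
    rfl

/-- The row of a white leaf with edge index `i` is determined by the neighbour of the leaf. -/
lemma sum_rows {b : ℕ} (i : Fin d) (K : (Fin b → Option (Fin d)) → S) :
    (∑ x : Fin b → Option (Fin d), if ∑ v, idx (x v) = Finsupp.single i 1 then K x else 0) =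
      ∑ v, K (Function.update (fun _ => none) v (some i)) := by
  classical
  rw [← Finset.sum_filter]
  have himg : (Finset.univ.filter fun x : Fin b → Option (Fin d) =>
      ∑ v, idx (x v) = Finsupp.single i 1) =
      Finset.univ.image fun v : Fin b => Function.update (fun _ => none) v (some i) := by
    ext x
    simp [sum_idx_eq_single_iff]
  rw [himg, Finset.sum_image]
  intro v _ v' _ h
  by_contra hne
  have := congrFun h v
  simp [Function.update_of_ne hne] at this

lemma leafSum_zero (β γ : (Fin d →₀ ℕ) → S) (a : Fin d → S) (b : ℕ) :
    leafSum β γ a b 0 = 0 := by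
  simp [leafSum]

/-- Deleting the marked leaf turns its edge into an extra leg of the black neighbour. The outcome
does not depend on the label of the leaf, and there are `w + 1` labels. -/
lemma leafSum_succ (β γ : (Fin d →₀ ℕ) → S) (a : Fin d → S) (b w : ℕ) :
    leafSum β γ a b (w + 1) = ((w + 1 : ℕ) : S) * markedSum β γ a b w := by
  classical
  have key : ∀ u₀ : Fin (w + 1),
      (∑ L : Fin (w + 1) → Fin b → Option (Fin d), if IsTreeMatrix L then
        (∑ i, if ∑ v, idx (L u₀ v) = Finsupp.single i 1 then a i else 0) *
        ((∏ v, β (∑ u, idx (L u v))) * ∏ u ∈ Finset.univ.erase u₀, γ (∑ v, idx (L u v)))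
        else 0) = markedSum β γ a b w := by
    intro u₀
    have herase : Finset.univ.erase u₀ = Finset.univ.map u₀.succAboveEmb := by
      ext u; simp [Fin.exists_succAbove_eq_iff]
    rw [← (Fin.insertNthEquiv (fun _ => Fin b → Option (Fin d)) u₀).sum_comp, Fintype.sum_prod_type,
      Finset.sum_comm, markedSum, Finset.sum_filter]
    refine Finset.sum_congr rfl fun L _ => ?_
    have h1 : ∀ x : Fin b → Option (Fin d),
        (if IsTreeMatrix (Fin.insertNthEquiv (fun _ => Fin b → Option (Fin d)) u₀ (x, L)) then
          (∑ i, if ∑ v, idx (Fin.insertNthEquiv (fun _ => Fin b → Option (Fin d)) u₀ (x, L) u₀ v)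
            = Finsupp.single i 1 then a i else 0) *
          ((∏ v, β (∑ u, idx (Fin.insertNthEquiv (fun _ => Fin b → Option (Fin d)) u₀ (x, L) u v)))
          * ∏ u ∈ Finset.univ.erase u₀,
            γ (∑ v, idx (Fin.insertNthEquiv (fun _ => Fin b → Option (Fin d)) u₀ (x, L) u v)))
          else 0) =
        ∑ i, if ∑ v, idx (x v) = Finsupp.single i 1 then
          (if IsTreeMatrix (u₀.insertNth (α := fun _ => Fin b → Option (Fin d)) x L) then
            a i * ((∏ v, β (idx (x v) + ∑ u, idx (L u v))) * ∏ u, γ (∑ v, idx (L u v)))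
            else 0) else 0 := by
      intro x
      have hins : Fin.insertNthEquiv (fun _ => Fin b → Option (Fin d)) u₀ (x, L) =
        u₀.insertNth (α := fun _ => Fin b → Option (Fin d)) x L := rfl
      rw [herase, hins]
      simp only [Fin.insertNth_apply_same, Finset.prod_map,
        Fin.coe_succAboveEmb, Fin.insertNth_apply_succAbove, Fin.sum_univ_succAbove _ u₀]
      split_ifs with h
      · rw [Finset.sum_mul]
        refine Finset.sum_congr rfl fun i _ => ?_
        split_ifs <;> simp
      · simp
    rw [Finset.sum_congr rfl fun x _ => h1 x, Finset.sum_comm]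
    simp only [sum_rows]
    have h2 : ∀ (v : Fin b) (i : Fin d), IsTreeMatrix (u₀.insertNth
        (α := fun _ => Fin b → Option (Fin d)) (Function.update (fun _ => none) v (some i)) L) ↔
        IsTreeMatrix L := fun v i => isTreeMatrix_addLeaf L u₀ v i
    simp only [h2]
    split_ifs with h
    · rw [Finset.sum_comm]
      refine Finset.sum_congr rfl fun v₀ _ => Finset.sum_congr rfl fun i _ => ?_
      congr 2
      refine Finset.prod_congr rfl fun v _ => ?_
      rw [add_comm]
      congr 2
      by_cases hv : v = v₀
      · subst hv; simp
      · simp [hv]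
    · simp
  rw [leafSum, Finset.sum_comm]
  simp only [Finset.sum_filter, key]
  simp

variable [Algebra ℝ S]

lemma derivation_prod {ι : Type*} [DecidableEq ι] (D : Derivation ℝ S S) (s : Finset ι)
    (f : ι → S) : D (∏ i ∈ s, f i) = ∑ i ∈ s, D (f i) * ∏ j ∈ s.erase i, f j := by
  induction s using Finset.induction_on with
  | empty => simp
  | insert a s ha ih =>
    rw [Finset.prod_insert ha, D.leibniz, ih, Finset.sum_insert ha, Finset.erase_insert ha,
      smul_eq_mul, smul_eq_mul, Finset.mul_sum, add_comm, mul_comm]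
    congr 1
    refine Finset.sum_congr rfl fun i hi => ?_
    have hne : a ≠ i := fun h => ha (h ▸ hi)
    rw [Finset.erase_insert_of_ne hne, Finset.prod_insert (by simp [ha])]
    ring

/-- Leibniz rule over the vertices: a differentiated black factor gains a leg contracted with `a`,
while a differentiated white factor is nonzero only at a leaf. -/
lemma derivation_treeSum (D : Derivation ℝ S S) {β γ : (Fin d →₀ ℕ) → S} {a : Fin d → S}
    (hβ : ∀ μ, D (β μ) = ∑ i, a i * β (μ + Finsupp.single i 1))
    (hγ : ∀ μ, D (γ μ) = -∑ i, if μ = Finsupp.single i 1 then a i else 0) (b w : ℕ) :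
    D (treeSum β γ b w) = markedSum β γ a b w - leafSum β γ a b w := by
  classical
  rw [treeSum, map_sum, markedSum, leafSum, ← Finset.sum_sub_distrib]
  refine Finset.sum_congr rfl fun L _ => ?_
  rw [D.leibniz, derivation_prod, derivation_prod, smul_eq_mul, smul_eq_mul, add_comm,
    sub_eq_add_neg, ← Finset.sum_neg_distrib, Finset.mul_sum, Finset.mul_sum]
  congr 1
  · refine Finset.sum_congr rfl fun v₀ _ => ?_
    rw [hβ, Finset.sum_mul, Finset.mul_sum]
    refine Finset.sum_congr rfl fun i _ => ?_
    rw [← Finset.mul_prod_erase Finset.univ (fun v => β (∑ u, idx (L u v) +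
      if v = v₀ then Finsupp.single i 1 else 0)) (Finset.mem_univ v₀), if_pos rfl]
    have herase : ∏ v ∈ Finset.univ.erase v₀, β (∑ u, idx (L u v) +
        if v = v₀ then Finsupp.single i 1 else 0) =
        ∏ v ∈ Finset.univ.erase v₀, β (∑ u, idx (L u v)) :=
      Finset.prod_congr rfl fun v hv => by rw [if_neg (Finset.ne_of_mem_erase hv), add_zero]
    rw [herase]
    ring
  · refine Finset.sum_congr rfl fun u₀ _ => ?_
    rw [hγ]
    ring

/-- The sum over all trees with less than `M` vertices of each colour, each divided by the number
of labellings. -/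
def treeTotal (β γ : (Fin d →₀ ℕ) → S) (M : ℕ) : S :=
  ∑ b ∈ Finset.range M, ∑ w ∈ Finset.range M,
    ((b.factorial : ℝ) * (w.factorial : ℝ))⁻¹ • treeSum β γ b w

lemma treeTotal_swap (β γ : (Fin d →₀ ℕ) → S) (M : ℕ) : treeTotal β γ M = treeTotal γ β M := by
  rw [treeTotal, treeTotal, Finset.sum_comm]
  simp only [treeSum_swap β γ, mul_comm]

/-- The sum over trees does not change under an infinitesimal shift of the black generating
function that is compensated by the linear part of the white one. -/
theorem derivation_treeTotal (D : Derivation ℝ S S) {β γ : (Fin d →₀ ℕ) → S} {a : Fin d → S}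
    (hβ : ∀ μ, D (β μ) = ∑ i, a i * β (μ + Finsupp.single i 1))
    (hγ : ∀ μ, D (γ μ) = -∑ i, if μ = Finsupp.single i 1 then a i else 0) (M : ℕ)
    (hM : ∀ b w, M ≤ w + 1 → markedSum β γ a b w = 0) : D (treeTotal β γ M) = 0 := by
  rw [treeTotal, map_sum]
  refine Finset.sum_eq_zero fun b _ => ?_
  rw [map_sum]
  -- For fixed `b` the sum over `w` telescopes: the leaf sum at `w + 1` is `w + 1` times the marked
  -- sum at `w`, which the ratio of factorials cancels. Only the last marked sum remains, and `hM`
  -- disposes of it.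
  have key : ∀ m, ∑ w ∈ Finset.range (m + 1),
      D (((b.factorial : ℝ) * (w.factorial : ℝ))⁻¹ • treeSum β γ b w) =
      ((b.factorial : ℝ) * (m.factorial : ℝ))⁻¹ • markedSum β γ a b m := by
    intro m
    induction m with
    | zero =>
      simp [derivation_treeSum D hβ hγ, leafSum_zero]
    | succ m ih =>
      rw [Finset.sum_range_succ, ih, D.map_smul, derivation_treeSum D hβ hγ, leafSum_succ,
        smul_sub]
      have : ((b.factorial : ℝ) * ((m + 1).factorial : ℝ))⁻¹ •
          (((m + 1 : ℕ) : S) * markedSum β γ a b m) =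
          ((b.factorial : ℝ) * (m.factorial : ℝ))⁻¹ • markedSum β γ a b m := by
        have hn : ((m + 1 : ℕ) : S) * markedSum β γ a b m =
            ((m + 1 : ℕ) : ℝ) • markedSum β γ a b m := by
          rw [← nsmul_eq_mul, Nat.cast_smul_eq_nsmul]
        rw [hn, smul_smul]
        congr 1
        have h1 := Nat.cast_ne_zero (R := ℝ).2 (Nat.factorial_ne_zero m)
        have h2 := Nat.cast_ne_zero (R := ℝ).2 (Nat.factorial_ne_zero b)
        have h3 := Nat.cast_ne_zero (R := ℝ).2 (Nat.succ_ne_zero m)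
        rw [Nat.factorial_succ]
        push_cast at h3 ⊢
        field_simp
      rw [this]
      abel
  rcases M with _ | m
  · simp
  · rw [key, hM b m le_rfl, smul_zero]

end TreeSum

/-! ### Degrees in trees, and the smallness of big trees -/

section Smallness

lemma exists_eq_single_of_degree_eq_one {σ : Type*} {μ : σ →₀ ℕ} (h : μ.degree = 1) :
    ∃ i, μ = Finsupp.single i 1 := by
  classical
  have hne : μ ≠ 0 := by rintro rfl; simp at h
  obtain ⟨i, hi⟩ := Finsupp.ne_iff.1 hne
  have hle : Finsupp.single i 1 ≤ μ := by
    rw [Finsupp.single_le_iff]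
    exact Nat.one_le_iff_ne_zero.2 hi
  have hd := congrArg Finsupp.degree (tsub_add_cancel_of_le hle)
  rw [map_add, h, Finsupp.degree_single] at hd
  have h0 : μ - Finsupp.single i 1 = 0 := (Finsupp.degree_eq_zero_iff _).1 (by omega)
  refine ⟨i, ?_⟩
  rw [← tsub_add_cancel_of_le hle, h0, zero_add]

variable {d b w : ℕ}

lemma sum_degree_white (L : Fin w → Fin b → Option (Fin d)) :
    ∑ u, (∑ v, idx (L u v)).degree = (edgeSet L).card := by
  simp [card_edgeSet]

lemma sum_degree_black (L : Fin w → Fin b → Option (Fin d)) :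
    ∑ v, (∑ u, idx (L u v)).degree = (edgeSet L).card := by
  rw [card_edgeSet, Finset.sum_comm]
  simp

lemma IsTreeMatrix.card_add_one {L : Fin w → Fin b → Option (Fin d)} (hL : IsTreeMatrix L) :
    (edgeSet L).card + 1 = b + w :=
  ((isTree_bipartiteGraph_iff _).1 hL).2

lemma IsTreeMatrix.degree_white_pos {L : Fin w → Fin b → Option (Fin d)} (hL : IsTreeMatrix L)
    (h : 2 ≤ b + w) (u : Fin w) : 1 ≤ (∑ v, idx (L u v)).degree := by
  have : Nontrivial (Fin b ⊕ Fin w) := by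
    rw [← Fintype.one_lt_card_iff_nontrivial]; simp; omega
  obtain ⟨p, hp⟩ := hL.connected.preconnected.exists_adj_of_nontrivial (Sum.inr u)
  rcases p with v | p
  · have hv : L u v ≠ none := by simpa using hp
    rw [map_sum]
    refine le_trans ?_ (Finset.single_le_sum (fun _ _ => Nat.zero_le _) (Finset.mem_univ v))
    simp [degree_idx, hv]
  · simp at hp

lemma IsTreeMatrix.degree_black_pos {L : Fin w → Fin b → Option (Fin d)} (hL : IsTreeMatrix L)
    (h : 2 ≤ b + w) (v : Fin b) : 1 ≤ (∑ u, idx (L u v)).degree :=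
  ((isTreeMatrix_flip L).2 hL).degree_white_pos (by omega) v

lemma prod_mem_pow_card {S ι : Type*} [CommRing S] (J : Ideal S) (s : Finset ι) (f : ι → S)
    (P : ι → Prop) [DecidablePred P] (h : ∀ i ∈ s, P i → f i ∈ J) :
    ∏ i ∈ s, f i ∈ J ^ (s.filter P).card := by
  rw [← Finset.prod_filter_mul_prod_filter_not s P]
  refine Ideal.mul_mem_right _ _ ?_
  rw [← Finset.prod_const]
  exact Ideal.prod_mem_prod fun i hi => h i (Finset.mem_filter.1 hi).1 (Finset.mem_filter.1 hi).2

/-- Let `p` be the number of black leaves and `q` that of white vertices of degree at most two.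
Summing degrees over each colour gives `2b ≤ |E| + p` and `3w ≤ |E| + 2q`. With `|E| + 1 = b + w`
these force `b + w ≤ 4(p + q)`, hence at least `N` factors lie in `J`. -/
lemma IsTreeMatrix.prod_mem_of_white {S : Type*} [CommRing S]
    {L : Fin w → Fin b → Option (Fin d)} (hL : IsTreeMatrix L) {J : Ideal S} {N : ℕ}
    {x : Fin b → S} {y : Fin w → S}
    (hx : ∀ v, (∑ u, idx (L u v)).degree = 1 → x v ∈ J)
    (hy : ∀ u, (∑ v, idx (L u v)).degree = 1 → y u ∈ J)
    (hy2 : ∀ u, (∑ v, idx (L u v)).degree = 2 → y u ∈ J)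
    (h : 4 * N + 2 ≤ b + w) : (∏ v, x v) * ∏ u, y u ∈ J ^ N := by
  have h1 := prod_mem_pow_card J Finset.univ x _ fun v _ => hx v
  have h2 := prod_mem_pow_card J Finset.univ y
    (fun u => (∑ v, idx (L u v)).degree = 1 ∨ (∑ v, idx (L u v)).degree = 2)
    fun u _ => by rintro (h | h); exacts [hy u h, hy2 u h]
  have h3 := Ideal.mul_mem_mul h1 h2
  rw [← pow_add] at h3
  refine Ideal.pow_le_pow_right ?_ h3
  have hc := hL.card_add_one
  have hb : b * 2 ≤ (edgeSet L).card +
      (Finset.univ.filter fun v => (∑ u, idx (L u v)).degree = 1).card := by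
    rw [← sum_degree_black, Finset.card_filter, ← Finset.sum_add_distrib]
    calc b * 2 = ∑ _v : Fin b, 2 := by simp
      _ ≤ _ := Finset.sum_le_sum fun v _ => by
        have := hL.degree_black_pos (by omega) v
        split_ifs <;> omega
  have hw : w * 3 ≤ (edgeSet L).card + 2 * (Finset.univ.filter fun u =>
      (∑ v, idx (L u v)).degree = 1 ∨ (∑ v, idx (L u v)).degree = 2).card := by
    rw [← sum_degree_white, Finset.card_filter, Finset.mul_sum, ← Finset.sum_add_distrib]
    calc w * 3 = ∑ _u : Fin w, 3 := by simp
      _ ≤ _ := Finset.sum_le_sum fun u _ => by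
        have := hL.degree_white_pos (by omega) u
        split_ifs <;> omega
  omega

/-- If leaves are small, and the vertices of degree two of one of the colours are small, then big
trees are very small. -/
lemma IsTreeMatrix.prod_mem {S : Type*} [CommRing S]
    {L : Fin w → Fin b → Option (Fin d)} (hL : IsTreeMatrix L) {J : Ideal S} {N : ℕ}
    {x : Fin b → S} {y : Fin w → S}
    (hx : ∀ v, (∑ u, idx (L u v)).degree = 1 → x v ∈ J)
    (hy : ∀ u, (∑ v, idx (L u v)).degree = 1 → y u ∈ J)
    (h2 : (∀ u, (∑ v, idx (L u v)).degree = 2 → y u ∈ J) ∨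
      ∀ v, (∑ u, idx (L u v)).degree = 2 → x v ∈ J)
    (h : 4 * N + 2 ≤ b + w) : (∏ v, x v) * ∏ u, y u ∈ J ^ N := by
  rcases h2 with h2 | h2
  · exact hL.prod_mem_of_white hx hy h2 h
  · rw [mul_comm]
    exact ((isTreeMatrix_flip L).2 hL).prod_mem_of_white hy hx h2 (by omega)

/-- If all degrees were at least two, there would be at least as many edges as vertices. -/
lemma IsTreeMatrix.exists_leaf {L : Fin w → Fin b → Option (Fin d)} (hL : IsTreeMatrix L)
    (h : 2 ≤ b + w) : (∃ v, (∑ u, idx (L u v)).degree = 1) ∨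
      ∃ u, (∑ v, idx (L u v)).degree = 1 := by
  by_contra hcon
  push Not at hcon
  have hc := hL.card_add_one
  have hb : b * 2 ≤ (edgeSet L).card := by
    rw [← sum_degree_black]
    calc b * 2 = ∑ _v : Fin b, 2 := by simp
      _ ≤ _ := Finset.sum_le_sum fun v _ => by
        have := hL.degree_black_pos h v
        have := hcon.1 v
        omega
  have hw : w * 2 ≤ (edgeSet L).card := by
    rw [← sum_degree_white]
    calc w * 2 = ∑ _v : Fin w, 2 := by simp
      _ ≤ _ := Finset.sum_le_sum fun u _ => by
        have := hL.degree_white_pos h u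
        have := hcon.2 u
        omega
  omega

end Smallness

/-! ### Sums over trees are invariant under shifts -/

section Shift

variable {d : ℕ}

lemma map_treeTotal {S S' : Type*} [CommRing S] [Algebra ℝ S] [CommRing S'] [Algebra ℝ S']
    (f : S →ₐ[ℝ] S') (β γ : (Fin d →₀ ℕ) → S) (M : ℕ) :
    f (treeTotal β γ M) = treeTotal (fun μ => f (β μ)) (fun μ => f (γ μ)) M := by
  simp [treeTotal, treeSum, map_sum, map_prod, map_smul]

lemma isTreeMatrix_single_black (L : Fin 0 → Fin 1 → Option (Fin d)) : IsTreeMatrix L := by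
  rw [IsTreeMatrix, isTree_bipartiteGraph_iff]
  refine ⟨?_, by simp [card_edgeSet]⟩
  have : Nonempty (Fin 1 ⊕ Fin 0) := ⟨Sum.inl 0⟩
  refine ⟨?_⟩
  rintro (p | p) (q | q)
  · rw [Subsingleton.elim p q]
  · exact q.elim0
  · exact p.elim0
  · exact p.elim0

/-- If the linear terms vanish, only the trees with a single vertex contribute. -/
lemma treeTotal_of_linear_eq_zero {S : Type*} [CommRing S] [Algebra ℝ S]
    {β γ : (Fin d →₀ ℕ) → S}
    (hβ : ∀ i, β (Finsupp.single i 1) = 0) (hγ : ∀ i, γ (Finsupp.single i 1) = 0) {M : ℕ}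
    (hM : 2 ≤ M) : treeTotal β γ M = β 0 + γ 0 := by
  classical
  have hβ' : ∀ μ : Fin d →₀ ℕ, μ.degree = 1 → β μ = 0 := fun μ h => by
    obtain ⟨i, rfl⟩ := exists_eq_single_of_degree_eq_one h
    exact hβ i
  have hγ' : ∀ μ : Fin d →₀ ℕ, μ.degree = 1 → γ μ = 0 := fun μ h => by
    obtain ⟨i, rfl⟩ := exists_eq_single_of_degree_eq_one h
    exact hγ i
  have hbig : ∀ b w, 2 ≤ b + w → treeSum β γ b w = 0 := by
    intro b w h
    refine Finset.sum_eq_zero fun L hL => ?_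
    rcases (Finset.mem_filter.1 hL).2.exists_leaf h with ⟨v, hv⟩ | ⟨u, hu⟩
    · rw [Finset.prod_eq_zero (Finset.mem_univ v) (hβ' _ hv), zero_mul]
    · rw [Finset.prod_eq_zero (i := u) (Finset.mem_univ u) (hγ' _ hu), mul_zero]
  -- The empty graph is not a tree: the edge count would read `1 = 0`.
  have h00 : treeSum β γ 0 0 = 0 := by
    refine Finset.sum_eq_zero fun L hL => ?_
    have := (Finset.mem_filter.1 hL).2.card_add_one
    omega
  have h10 : ∀ β γ : (Fin d →₀ ℕ) → S, treeSum β γ 1 0 = β 0 := fun β γ => by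
    simp [treeSum, isTreeMatrix_single_black]
  obtain ⟨m, rfl⟩ : ∃ m, M = m + 2 := ⟨M - 2, by omega⟩
  rw [treeTotal, Finset.sum_range_succ', Finset.sum_range_succ', Finset.sum_range_succ',
    Finset.sum_range_succ', Finset.sum_eq_zero, Finset.sum_eq_zero, Finset.sum_range_succ',
    Finset.sum_range_succ', Finset.sum_eq_zero]
  · simp [h00, h10, treeSum_swap β γ 0 1, hbig]
  · intro w _
    rw [hbig _ _ (by omega), smul_zero]
  · intro w _
    rw [hbig _ _ (by omega), smul_zero]
  · intro b _
    refine Finset.sum_eq_zero fun w _ => ?_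
    rw [hbig _ _ (by omega), smul_zero]

variable {R : Type*} [CommRing R]

/-- The derivative in direction `a`, on the level of Taylor coefficients. -/
def dirDeriv (a : Fin d → R) (β : (Fin d →₀ ℕ) → R) (μ : Fin d →₀ ℕ) : R :=
  ∑ i, a i * β (μ + Finsupp.single i 1)

/-- Each derivative contributes one component of `a`, so the Taylor expansion in direction `a` stops
after `N` terms once `J ^ N = ⊥`. -/
lemma dirDeriv_iterate_mem {J : Ideal R} {a : Fin d → R} (ha : ∀ i, a i ∈ J)
    (β : (Fin d →₀ ℕ) → R) (k : ℕ) (μ : Fin d →₀ ℕ) : (dirDeriv a)^[k] β μ ∈ J ^ k := by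
  induction k generalizing μ with
  | zero => simp
  | succ k ih =>
    rw [Function.iterate_succ_apply', pow_succ']
    exact Ideal.sum_mem _ fun i _ => Ideal.mul_mem_mul (ha i) (ih _)

lemma dirDeriv_iterate_mem_of_mem {J : Ideal R} {a : Fin d → R} (ha : ∀ i, a i ∈ J)
    {β : (Fin d →₀ ℕ) → R} {μ : Fin d →₀ ℕ} (h : β μ ∈ J) (k : ℕ) :
    (dirDeriv a)^[k] β μ ∈ J := by
  rcases k with _ | k
  · exact h
  · exact Ideal.pow_le_self (Nat.succ_ne_zero k) (dirDeriv_iterate_mem ha β _ μ)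

lemma dirDeriv_sub (a : Fin d → R) (β β' : (Fin d →₀ ℕ) → R) :
    dirDeriv a (β - β') = dirDeriv a β - dirDeriv a β' := by
  funext μ
  simp [dirDeriv, mul_sub]

lemma dirDeriv_iterate_sub (a : Fin d → R) (β β' : (Fin d →₀ ℕ) → R) (k : ℕ) :
    (dirDeriv a)^[k] (β - β') = (dirDeriv a)^[k] β - (dirDeriv a)^[k] β' := by
  induction k with
  | zero => rfl
  | succ k ih => simp only [Function.iterate_succ_apply', ih, dirDeriv_sub]

/-- The Taylor coefficients of a linear function. -/
def linear (a : Fin d → R) (μ : Fin d →₀ ℕ) : R :=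
  ∑ i, if μ = Finsupp.single i 1 then a i else 0

@[simp] lemma linear_single (a : Fin d → R) (i : Fin d) :
    linear a (Finsupp.single i 1) = a i := by
  simp [linear, Finsupp.single_left_inj]

lemma linear_of_degree_ne_one (a : Fin d → R) {μ : Fin d →₀ ℕ} (h : μ.degree ≠ 1) :
    linear a μ = 0 := by
  refine Finset.sum_eq_zero fun i _ => if_neg ?_
  rintro rfl
  simp at h

lemma dirDeriv_linear (a c : Fin d → R) (μ : Fin d →₀ ℕ) :
    dirDeriv a (linear c) μ = if μ = 0 then ∑ i, a i * c i else 0 := by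
  split_ifs with h
  · subst h
    simp [dirDeriv]
  · refine Finset.sum_eq_zero fun i _ => ?_
    rw [linear_of_degree_ne_one, mul_zero]
    have : μ.degree ≠ 0 := fun h0 => h ((Finsupp.degree_eq_zero_iff μ).1 h0)
    simp only [map_add, Finsupp.degree_single]
    omega

lemma dirDeriv_dirDeriv_linear (a c : Fin d → R) : dirDeriv a (dirDeriv a (linear c)) = 0 := by
  funext μ
  rw [dirDeriv]
  refine Finset.sum_eq_zero fun i _ => ?_
  rw [dirDeriv_linear, if_neg, mul_zero]
  intro h
  simpa using congrArg Finsupp.degree h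

variable [Algebra ℝ R]

/-- The Taylor coefficients at `a` of the function with Taylor coefficients `β` at zero, up to
terms of order `N` in `a`. -/
def translate (N : ℕ) (a : Fin d → R) (β : (Fin d →₀ ℕ) → R) (μ : Fin d →₀ ℕ) : R :=
  ∑ k ∈ Finset.range N, ((k.factorial : ℝ))⁻¹ • (dirDeriv a)^[k] β μ

lemma translate_sub (N : ℕ) (a : Fin d → R) (β β' : (Fin d →₀ ℕ) → R) (μ : Fin d →₀ ℕ) :
    translate N a (β - β') μ = translate N a β μ - translate N a β' μ := by
  simp [translate, dirDeriv_iterate_sub, smul_sub]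

lemma translate_mem {J : Ideal R} {a : Fin d → R} (ha : ∀ i, a i ∈ J) {β : (Fin d →₀ ℕ) → R}
    {μ : Fin d →₀ ℕ} (h : β μ ∈ J) (N : ℕ) : translate N a β μ ∈ J :=
  Submodule.sum_mem _ fun k _ =>
    Submodule.smul_of_tower_mem J _ (dirDeriv_iterate_mem_of_mem ha h k)

/-- A linear function has only terms of order zero and one in the shift; `2 ≤ N` ensures that the
truncation keeps both. -/
lemma translate_linear {N : ℕ} (hN : 2 ≤ N) (a c : Fin d → R) (μ : Fin d →₀ ℕ) :
    translate N a (linear c) μ = linear c μ + if μ = 0 then ∑ i, a i * c i else 0 := by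
  have h : ∀ k, (dirDeriv a)^[k + 2] (linear c) = 0 := by
    intro k
    induction k with
    | zero => exact dirDeriv_dirDeriv_linear a c
    | succ k ih =>
      rw [add_right_comm, Function.iterate_succ_apply', ih]
      funext μ
      simp [dirDeriv]
  obtain ⟨m, rfl⟩ : ∃ m, N = m + 2 := ⟨N - 2, by omega⟩
  rw [translate, Finset.sum_range_succ', Finset.sum_range_succ', Finset.sum_eq_zero]
  · simp [dirDeriv_linear, add_comm]
  · intro k _
    rw [add_assoc, h]
    simp

open Polynomial in
/-- The sum over trees does not change when the black function is shifted by `a`, and the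
linear function `a` is subtracted from the white one. -/
theorem treeTotal_translate {J : Ideal R} {N : ℕ} (hN : 0 < N) (hJ : J ^ N = ⊥) {a : Fin d → R}
    (ha : ∀ i, a i ∈ J) {β γ : (Fin d →₀ ℕ) → R} (hβ : ∀ μ, μ.degree = 1 → β μ ∈ J)
    (hγ : ∀ μ, μ.degree = 1 → γ μ ∈ J)
    (h2 : (∀ μ, μ.degree = 2 → γ μ ∈ J) ∨ (∀ μ, μ.degree = 2 → β μ ∈ J)) {M : ℕ}
    (hM : 4 * N + 3 ≤ M) :
    treeTotal (translate N a β) (γ - linear a) M = treeTotal β γ M := by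
  classical
  let J' : Ideal R[X] := J.map (C : R →+* R[X])
  have hJ' : J' ^ N = ⊥ := by
    rw [← Ideal.map_pow, hJ, Ideal.map_bot]
  have hC : ∀ {r : R}, r ∈ J → (C r : R[X]) ∈ J' := fun h => Ideal.mem_map_of_mem _ h
  let D : Derivation ℝ R[X] R[X] := (derivative' (R := R)).restrictScalars ℝ
  have hD : ∀ p : R[X], D p = derivative p := fun _ => rfl
  -- The path from the original data at `X = 0` to the shifted data at `X = 1`: `β` is translated by
  -- `X a`, and `X` times the linear function `a` is subtracted from `γ`.
  let β' : (Fin d →₀ ℕ) → R[X] := fun μ =>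
    ∑ k ∈ Finset.range N, ((k.factorial : ℝ))⁻¹ • (C ((dirDeriv a)^[k] β μ) * X ^ k)
  let γ' : (Fin d →₀ ℕ) → R[X] := fun μ => C (γ μ) - C (linear a μ) * X
  have hDβ : ∀ μ, D (β' μ) = ∑ i, C (a i) * β' (μ + Finsupp.single i 1) := by
    intro μ
    have e1 : ∑ i, C (a i) * β' (μ + Finsupp.single i 1) =
        ∑ k ∈ Finset.range N, ((k.factorial : ℝ))⁻¹ • (C ((dirDeriv a)^[k + 1] β μ) * X ^ k) := by
      simp only [β', Finset.mul_sum]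
      rw [Finset.sum_comm]
      refine Finset.sum_congr rfl fun k _ => ?_
      rw [Function.iterate_succ_apply', dirDeriv, map_sum, Finset.sum_mul, Finset.smul_sum]
      refine Finset.sum_congr rfl fun i _ => ?_
      rw [mul_smul_comm, C_mul, mul_assoc]
    obtain ⟨m, rfl⟩ : ∃ m, N = m + 1 := ⟨N - 1, by omega⟩
    -- The truncated exponential series satisfies the exact differential equation because the first
    -- omitted term is already zero.
    have hz : (dirDeriv a)^[m + 1] β μ = 0 := by
      have := dirDeriv_iterate_mem ha β (m + 1) μ
      rwa [hJ, Ideal.mem_bot] at this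
    rw [e1, Finset.sum_range_succ, hz, map_zero, zero_mul, smul_zero, add_zero]
    simp only [β']
    rw [map_sum D, Finset.sum_range_succ']
    have e0 : D (((Nat.factorial 0 : ℕ) : ℝ)⁻¹ • (C ((dirDeriv a)^[0] β μ) * X ^ 0)) = 0 := by
      rw [D.map_smul, hD]
      simp
    rw [e0, add_zero]
    refine Finset.sum_congr rfl fun k _ => ?_
    rw [D.map_smul, hD, derivative_C_mul_X_pow, Nat.add_sub_cancel, Nat.factorial_succ]
    have e2 : (C ((dirDeriv a)^[k + 1] β μ * ((k + 1 : ℕ) : R)) * X ^ k : R[X]) =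
        ((k + 1 : ℕ) : ℝ) • (C ((dirDeriv a)^[k + 1] β μ) * X ^ k) := by
      rw [Nat.cast_smul_eq_nsmul, nsmul_eq_mul, C_mul, map_natCast]
      ring
    rw [e2, smul_smul]
    congr 1
    have h1 := Nat.cast_ne_zero (R := ℝ).2 (Nat.factorial_ne_zero k)
    have h3 := Nat.cast_ne_zero (R := ℝ).2 (Nat.succ_ne_zero k)
    push_cast at h3 ⊢
    field_simp
  have hDγ : ∀ μ, D (γ' μ) = -∑ i, if μ = Finsupp.single i 1 then C (a i) else 0 := by
    intro μ
    rw [hD, derivative_sub, derivative_C, derivative_C_mul_X, zero_sub, linear, map_sum]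
    congr 1
    refine Finset.sum_congr rfl fun i _ => ?_
    split_ifs <;> simp
  have hβ'J : ∀ μ, β μ ∈ J → β' μ ∈ J' := fun μ h =>
    Submodule.sum_mem _ fun k _ => Submodule.smul_of_tower_mem J' _
      (Ideal.mul_mem_right _ _ (hC (dirDeriv_iterate_mem_of_mem ha h k)))
  have hlin : ∀ μ, linear a μ ∈ J := fun μ =>
    Ideal.sum_mem _ fun i _ => by split_ifs; exacts [ha i, J.zero_mem]
  have hγ'J : ∀ μ, γ μ ∈ J → γ' μ ∈ J' := fun μ h =>
    Ideal.sub_mem _ (hC h) (Ideal.mul_mem_right _ _ (hC (hlin μ)))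
  have hvan : ∀ b w, M ≤ w + 1 → markedSum β' γ' (fun i => C (a i)) b w = 0 := by
    intro b w hw
    refine Finset.sum_eq_zero fun L hL => Finset.sum_eq_zero fun v₀ _ =>
      Finset.sum_eq_zero fun i _ => ?_
    rw [← Ideal.mem_bot, ← hJ', ← mul_assoc]
    -- The extra leg raises the degree of `v₀`, so the factor there need no longer be small. The
    -- coefficient `a i ∈ J` is assigned to `v₀` instead, and the count for the tree without the leg
    -- applies.
    have hup : C (a i) * ∏ v, β' (∑ u, idx (L u v) + if v = v₀ then Finsupp.single i 1 else 0) =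
        ∏ v, (if v = v₀ then C (a i) else 1) *
          β' (∑ u, idx (L u v) + if v = v₀ then Finsupp.single i 1 else 0) := by
      rw [Finset.prod_mul_distrib]
      simp
    rw [hup]
    have hx : ∀ v, β (∑ u, idx (L u v)) ∈ J → (if v = v₀ then C (a i) else 1) *
          β' (∑ u, idx (L u v) + if v = v₀ then Finsupp.single i 1 else 0) ∈ J' := by
      intro v hv
      split_ifs
      · exact Ideal.mul_mem_right _ _ (hC (ha i))
      · rw [one_mul, add_zero]
        exact hβ'J _ hv
    refine (Finset.mem_filter.1 hL).2.prod_mem (fun v hv => hx v (hβ _ hv))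
      (fun u hu => hγ'J _ (hγ _ hu)) ?_ (by omega)
    exact h2.imp (fun h u hu => hγ'J _ (h _ hu)) fun h v hv => hx v (h _ hv)
  have hzero := derivation_treeTotal D hDβ hDγ M hvan
  rw [hD] at hzero
  -- Characteristic zero: a polynomial with zero derivative is constant, so its values at `1` and
  -- `0` agree.
  have : IsAddTorsionFree R := by
    have : Module ℚ R := Module.compHom R (algebraMap ℚ ℝ)
    exact IsAddTorsionFree.of_module_rat R
  have hconst := Polynomial.eq_C_of_derivative_eq_zero hzero
  let ev : R → R[X] →ₐ[ℝ] R := fun r => (aeval r).restrictScalars ℝ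
  have hev : ∀ r s, ev r (treeTotal β' γ' M) = ev s (treeTotal β' γ' M) := by
    intro r s
    rw [hconst]
    simp [ev]
  have h01 := hev 1 0
  rw [map_treeTotal, map_treeTotal] at h01
  convert h01 using 2
  · funext μ
    simp [ev, β', translate]
  · funext μ
    simp [ev, γ']
  · funext μ
    obtain ⟨m, rfl⟩ : ∃ m, N = m + 1 := ⟨N - 1, by omega⟩
    simp [ev, β', Finset.sum_range_succ', eval_finsetSum]
  · funext μ
    simp [ev, γ']

/-- The sum over trees is the value of `β(q) + γ(η) - η q` at its critical point. -/
theorem treeTotal_eq_critical_value {J : Ideal R} {N : ℕ} (hN : 2 ≤ N) (hJ : J ^ N = ⊥)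
    {q η : Fin d → R} (hq : ∀ i, q i ∈ J) (hη : ∀ i, η i ∈ J) {β γ : (Fin d →₀ ℕ) → R}
    (hβ : ∀ μ, μ.degree = 1 → β μ ∈ J) (hγ : ∀ μ, μ.degree = 1 → γ μ ∈ J)
    (hγ2 : ∀ μ, μ.degree = 2 → γ μ ∈ J)
    (hηeq : ∀ i, translate N q β (Finsupp.single i 1) = η i)
    (hqeq : ∀ i, translate N η γ (Finsupp.single i 1) = q i) {M : ℕ} (hM : 4 * N + 3 ≤ M) :
    treeTotal β γ M = translate N q β 0 + translate N η γ 0 - ∑ i, η i * q i := by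
  have hlin : ∀ μ, linear q μ ∈ J := fun μ =>
    Ideal.sum_mem _ fun i _ => by split_ifs; exacts [hq i, J.zero_mem]
  have hne : ∀ i : Fin d, Finsupp.single i 1 ≠ (0 : Fin d →₀ ℕ) := fun i h => by
    simpa using congrArg Finsupp.degree h
  -- In the second translation the small vertices of degree two belong to the function being
  -- translated; this is the other branch of the alternative in `treeTotal_translate`.
  rw [← treeTotal_translate (by omega) hJ hq hβ hγ (Or.inl hγ2) hM, treeTotal_swap,
    ← treeTotal_translate (γ := translate N q β) (β := γ - linear q) (by omega) hJ hη (fun μ h => Ideal.sub_mem _ (hγ μ h) (hlin μ))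
      (fun μ h => translate_mem hq (hβ μ h) N)
      (Or.inr fun μ h => Ideal.sub_mem _ (hγ2 μ h) (hlin μ)) hM,
    treeTotal_of_linear_eq_zero _ _ (by omega)]
  -- The term `-∑ η q` arises from translating the subtracted linear function `q` by `η`.
  · rw [translate_sub, translate_linear hN, Pi.sub_apply, linear_of_degree_ne_one q (by simp),
      linear_of_degree_ne_one η (by simp)]
    simp
    ring
  · intro i
    rw [translate_sub, translate_linear hN, hqeq]
    simp [hne]
  · intro i
    simp [hηeq]

end Shift

/-! ### Multi-indices and tuples -/

section Tuples

variable {d : ℕ}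

/-- The multi-index of a tuple of indices. -/
def content {k : ℕ} (t : Fin k → Fin d) : Fin d →₀ ℕ := ∑ j, Finsupp.single (t j) 1

lemma degree_content {k : ℕ} (t : Fin k → Fin d) : (content t).degree = k := by
  simp [content]

/-- The factorial of a multi-index. -/
def multiFactorial (μ : Fin d →₀ ℕ) : ℝ := ∏ i, ((μ i).factorial : ℝ)

lemma multiFactorial_ne_zero (μ : Fin d →₀ ℕ) : multiFactorial μ ≠ 0 :=
  Finset.prod_ne_zero_iff.2 fun _ _ => Nat.cast_ne_zero.2 (Nat.factorial_ne_zero _)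

@[simp] lemma multiFactorial_zero : multiFactorial (0 : Fin d →₀ ℕ) = 1 := by
  simp [multiFactorial]

lemma multiFactorial_add_single (μ : Fin d →₀ ℕ) (i : Fin d) :
    multiFactorial (μ + Finsupp.single i 1) = (μ i + 1) * multiFactorial μ := by
  rw [multiFactorial, multiFactorial, ← Finset.mul_prod_erase _ _ (Finset.mem_univ i),
    ← Finset.mul_prod_erase _ (fun i => ((μ i).factorial : ℝ)) (Finset.mem_univ i), ← mul_assoc]
  congr 1
  · simp [Nat.factorial_succ]
  · refine Finset.prod_congr rfl fun j hj => ?_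
    simp [Finsupp.single_eq_of_ne (Finset.ne_of_mem_erase hj)]

lemma content_cons {k : ℕ} (i : Fin d) (t : Fin k → Fin d) :
    content (Fin.cons i t : Fin (k + 1) → Fin d) = Finsupp.single i 1 + content t := by
  simp [content, Fin.sum_univ_succ]

lemma sum_fin_succ {k : ℕ} {M : Type*} [AddCommMonoid M] (f : (Fin (k + 1) → Fin d) → M) :
    ∑ t, f t = ∑ i, ∑ t : Fin k → Fin d, f (Fin.cons i t : Fin (k + 1) → Fin d) := by
  rw [← (Fin.consEquiv fun _ => Fin d).sum_comp, Fintype.sum_prod_type]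
  rfl

open Classical in
/-- The number of tuples with multi-index `μ` is a multinomial coefficient. -/
lemma card_content_eq (k : ℕ) (μ : Fin d →₀ ℕ) (h : μ.degree = k) :
    ((Finset.univ.filter fun t : Fin k → Fin d => content t = μ).card : ℝ) * multiFactorial μ =
      k.factorial := by
  induction k generalizing μ with
  | zero =>
    obtain rfl := (Finsupp.degree_eq_zero_iff μ).1 h
    simp [content]
  | succ k ih =>
    have hcard : ((Finset.univ.filter fun t : Fin (k + 1) → Fin d => content t = μ).card : ℝ) =
        ∑ i, ((Finset.univ.filter fun t : Fin k → Fin d =>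
          Finsupp.single i 1 + content t = μ).card : ℝ) := by
      simp only [Finset.card_filter, Nat.cast_sum]
      rw [sum_fin_succ]
      simp only [content_cons]
    -- Tuples with first entry `i` make up a share proportional to `μ i`, and the `μ i` add up to
    -- the degree `k + 1`.
    have hterm : ∀ i, ((Finset.univ.filter fun t : Fin k → Fin d =>
          Finsupp.single i 1 + content t = μ).card : ℝ) * multiFactorial μ =
          (μ i : ℝ) * k.factorial := by
      intro i
      by_cases hi : μ i = 0
      · rw [Finset.filter_false_of_mem, hi]
        · simp
        · rintro t _ rfl
          simp at hi
      · have hle : Finsupp.single i 1 ≤ μ := by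
          rw [Finsupp.single_le_iff]
          exact Nat.one_le_iff_ne_zero.2 hi
        obtain ⟨ν, rfl⟩ := exists_add_of_le hle
        have hν : ν.degree = k := by
          rw [map_add, Finsupp.degree_single] at h
          omega
        simp only [add_right_inj]
        rw [add_comm (Finsupp.single i 1) ν, multiFactorial_add_single, ← ih ν hν]
        simp
        ring
    rw [hcard, Finset.sum_mul, Finset.sum_congr rfl fun i _ => hterm i, ← Finset.sum_mul,
      ← Nat.cast_sum, ← Finsupp.degree_eq_sum, h, Nat.factorial_succ]
    push_cast
    ring

lemma exists_content_eq (μ : Fin d →₀ ℕ) : ∃ t : Fin μ.degree → Fin d, content t = μ := by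
  classical
  by_contra hcon
  push Not at hcon
  have h := card_content_eq _ μ rfl
  rw [Finset.filter_false_of_mem fun t _ => hcon t] at h
  simp only [Finset.card_empty, Nat.cast_zero, zero_mul] at h
  exact Nat.cast_ne_zero.2 (Nat.factorial_ne_zero _) h.symm

/-- The content records the sizes of the fibres; bijections between corresponding fibres glue to a
permutation. -/
lemma exists_perm_of_content_eq {k : ℕ} {t t' : Fin k → Fin d} (h : content t = content t') :
    ∃ σ : Equiv.Perm (Fin k), t' ∘ σ = t := by
  classical
  have hcard : ∀ (t : Fin k → Fin d) i, Fintype.card {j // t j = i} = content t i := by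
    intro t i
    rw [Fintype.card_subtype, Finset.card_filter, content, Finsupp.finsetSum_apply]
    refine Finset.sum_congr rfl fun j _ => ?_
    rw [Finsupp.single_apply]
  let e : ∀ i, {j // t j = i} ≃ {j // t' j = i} := fun i =>
    Fintype.equivOfCardEq (by rw [hcard, hcard, h])
  exact ⟨Equiv.ofFiberEquiv e, funext fun j => Equiv.ofFiberEquiv_map e j⟩

/-- The multi-indices of degree less than `N`. -/
def degreeLT (d N : ℕ) : Finset (Fin d →₀ ℕ) :=
  (Finset.range N).biUnion fun k => Finset.univ.image fun t : Fin k → Fin d => content t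

lemma mem_degreeLT {N : ℕ} {μ : Fin d →₀ ℕ} : μ ∈ degreeLT d N ↔ μ.degree < N := by
  simp only [degreeLT, Finset.mem_biUnion, Finset.mem_range, Finset.mem_image, Finset.mem_univ,
    true_and]
  constructor
  · rintro ⟨k, hk, t, rfl⟩
    rwa [degree_content]
  · intro h
    exact ⟨_, h, exists_content_eq μ⟩

open Classical in
lemma sum_tuples {M : Type*} [AddCommMonoid M] (N : ℕ)
    (h : ∀ k, (Fin k → Fin d) → M) :
    ∑ k ∈ Finset.range N, ∑ t : Fin k → Fin d, h k t =
      ∑ μ ∈ degreeLT d N, ∑ t : Fin μ.degree → Fin d with content t = μ, h _ t := by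
  have h1 : ∀ k ∈ Finset.range N, ∑ t : Fin k → Fin d, h k t =
      ∑ μ ∈ degreeLT d N with μ.degree = k,
        ∑ t : Fin k → Fin d with content t = μ, h k t := by
    intro k hk
    rw [Finset.sum_fiberwise_of_maps_to]
    intro t _
    rw [Finset.mem_filter, mem_degreeLT, degree_content]
    exact ⟨Finset.mem_range.1 hk, rfl⟩
  rw [Finset.sum_congr rfl h1,
    ← Finset.sum_fiberwise_of_maps_to (t := Finset.range N) (g := Finsupp.degree)
      (fun μ hμ => Finset.mem_range.2 (mem_degreeLT.1 hμ))]
  refine Finset.sum_congr rfl fun k _ => Finset.sum_congr rfl fun μ hμ => ?_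
  obtain rfl := (Finset.mem_filter.1 hμ).2
  rfl

/-- There are `k! / μ!` tuples of content `μ`, which turns the weight `1 / k!` into `1 / μ!`. -/
lemma sum_tuples_content {M : Type*} [AddCommGroup M] [Module ℝ M] (N : ℕ)
    (h : (Fin d →₀ ℕ) → M) :
    ∑ k ∈ Finset.range N, ∑ t : Fin k → Fin d, ((k.factorial : ℝ))⁻¹ • h (content t) =
      ∑ μ ∈ degreeLT d N, (multiFactorial μ)⁻¹ • h μ := by
  classical
  rw [sum_tuples N fun k t => ((k.factorial : ℝ))⁻¹ • h (content t)]
  refine Finset.sum_congr rfl fun μ _ => ?_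
  rw [Finset.sum_congr rfl fun t ht => by rw [(Finset.mem_filter.1 ht).2], Finset.sum_const,
    ← Nat.cast_smul_eq_nsmul ℝ, smul_smul]
  congr 1
  have h1 := card_content_eq _ μ rfl
  have h2 : ((μ.degree.factorial : ℕ) : ℝ) ≠ 0 := Nat.cast_ne_zero.2 (Nat.factorial_ne_zero _)
  have h3 := multiFactorial_ne_zero μ
  field_simp
  exact h1

lemma dirDeriv_iterate_eq {R : Type*} [CommRing R] (a : Fin d → R) (β : (Fin d →₀ ℕ) → R)
    (k : ℕ) (μ : Fin d →₀ ℕ) :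
    (dirDeriv a)^[k] β μ = ∑ t : Fin k → Fin d, (∏ j, a (t j)) * β (μ + content t) := by
  induction k generalizing μ with
  | zero => simp [content]
  | succ k ih =>
    rw [Function.iterate_succ_apply', dirDeriv, sum_fin_succ]
    refine Finset.sum_congr rfl fun i _ => ?_
    rw [ih, Finset.mul_sum]
    refine Finset.sum_congr rfl fun t _ => ?_
    rw [content_cons, Fin.prod_univ_succ, add_assoc]
    simp [mul_assoc]

lemma prod_content {A : Type*} [CommMonoid A] (x : Fin d → A) {k : ℕ} (t : Fin k → Fin d) :
    ((content t).prod fun i e => x i ^ e) = ∏ j, x (t j) := by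
  rw [content, ← Finsupp.prod_finsetSum_index (by simp) (by simp [pow_add])]
  simp

/-- The iterated directional derivatives rewritten as a sum over monomials, the form in which a
translation can be compared with a substitution into a power series. -/
lemma translate_eq {R : Type*} [CommRing R] [Algebra ℝ R] (N : ℕ) (a : Fin d → R)
    (β : (Fin d →₀ ℕ) → R) (μ : Fin d →₀ ℕ) :
    translate N a β μ = ∑ ν ∈ degreeLT d N,
      (multiFactorial ν)⁻¹ • ((ν.prod fun i e => a i ^ e) * β (μ + ν)) := by
  rw [← sum_tuples_content, translate]
  refine Finset.sum_congr rfl fun k _ => ?_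
  rw [dirDeriv_iterate_eq, Finset.smul_sum]
  simp only [prod_content]

end Tuples

/-! ### The filtration of formal power series by order -/

section Order

variable {τ : Type}

/-- The ideal of formal power series of order at least `N`. -/
def orderIdeal (τ : Type) (N : ℕ) : Ideal (MvPowerSeries τ ℝ) where
  carrier := {f | ∀ n : τ →₀ ℕ, n.degree < N → MvPowerSeries.coeff n f = 0}
  zero_mem' := fun n _ => by simp
  add_mem' := fun hf hg n hn => by rw [map_add, hf n hn, hg n hn, add_zero]
  smul_mem' := fun g f hf n hn => by
    classical
    rw [smul_eq_mul, MvPowerSeries.coeff_mul]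
    refine Finset.sum_eq_zero fun p hp => ?_
    have h := congrArg Finsupp.degree (Finset.HasAntidiagonal.mem_antidiagonal.1 hp)
    rw [map_add] at h
    rw [hf p.2 (by omega), mul_zero]

lemma mem_orderIdeal_zero (f : MvPowerSeries τ ℝ) : f ∈ orderIdeal τ 0 := fun n hn => by
  omega

lemma mem_orderIdeal_one {f : MvPowerSeries τ ℝ} :
    f ∈ orderIdeal τ 1 ↔ MvPowerSeries.constantCoeff f = 0 := by
  constructor
  · intro h
    simpa using h 0 (by simp)
  · intro h n hn
    obtain rfl := (Finsupp.degree_eq_zero_iff n).1 (by omega)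
    simpa using h

lemma mul_mem_orderIdeal {M N : ℕ} {f g : MvPowerSeries τ ℝ} (hf : f ∈ orderIdeal τ M)
    (hg : g ∈ orderIdeal τ N) : f * g ∈ orderIdeal τ (M + N) := by
  classical
  intro n hn
  rw [MvPowerSeries.coeff_mul]
  refine Finset.sum_eq_zero fun p hp => ?_
  have h := congrArg Finsupp.degree (Finset.HasAntidiagonal.mem_antidiagonal.1 hp)
  rw [map_add] at h
  rcases lt_or_ge p.1.degree M with h1 | h1
  · rw [hf _ h1, zero_mul]
  · rw [hg _ (by omega), mul_zero]

lemma orderIdeal_anti {M N : ℕ} (h : M ≤ N) : orderIdeal τ N ≤ orderIdeal τ M :=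
  fun _ hf n hn => hf n (by omega)

lemma orderIdeal_one_pow_le (N : ℕ) : orderIdeal τ 1 ^ N ≤ orderIdeal τ N := by
  induction N with
  | zero => exact fun f _ => mem_orderIdeal_zero f
  | succ N ih =>
    rw [pow_succ, Ideal.mul_le]
    exact fun f hf g hg => mul_mem_orderIdeal (ih hf) hg

lemma eq_of_forall_sub_mem {f g : MvPowerSeries τ ℝ} (h : ∀ N, f - g ∈ orderIdeal τ N) :
    f = g := by
  ext n
  have := h (n.degree + 1) n (by omega)
  rwa [map_sub, sub_eq_zero] at this

lemma coeff_eq_of_sub_mem {N : ℕ} {f g : MvPowerSeries τ ℝ} (h : f - g ∈ orderIdeal τ N)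
    {n : τ →₀ ℕ} (hn : n.degree < N) :
    MvPowerSeries.coeff n f = MvPowerSeries.coeff n g := by
  have := h n hn
  rwa [map_sub, sub_eq_zero] at this

variable {σ : Type} {a a' : σ → MvPowerSeries τ ℝ}

lemma monomial_mem (ha : ∀ i, a i ∈ orderIdeal τ 1) (μ : σ →₀ ℕ) :
    (μ.prod fun i e => a i ^ e) ∈ orderIdeal τ μ.degree := by
  refine orderIdeal_one_pow_le _ ?_
  rw [Finsupp.degree_apply, ← Finset.prod_pow_eq_pow_sum]
  exact Ideal.prod_mem_prod fun i _ => Ideal.pow_mem_pow (ha i) _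

lemma monomial_sub_mem {k : ℕ} (h : ∀ i, a i - a' i ∈ orderIdeal τ k) (μ : σ →₀ ℕ) :
    (μ.prod fun i e => a i ^ e) - (μ.prod fun i e => a' i ^ e) ∈ orderIdeal τ k := by
  rw [← Ideal.Quotient.eq_zero_iff_mem, map_sub, sub_eq_zero, map_finsuppProd, map_finsuppProd]
  refine Finsupp.prod_congr fun i _ => ?_
  rw [map_pow, map_pow, Ideal.Quotient.eq.2 (h i)]

/-- Splitting off one variable writes the difference as a sum of products, each of a difference of
order `k` and a remaining factor of order at least one. -/
lemma monomial_sub_mem_succ (ha : ∀ i, a i ∈ orderIdeal τ 1) (ha' : ∀ i, a' i ∈ orderIdeal τ 1)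
    {k : ℕ} (h : ∀ i, a i - a' i ∈ orderIdeal τ k) {μ : σ →₀ ℕ} (hμ : 2 ≤ μ.degree) :
    (μ.prod fun i e => a i ^ e) - (μ.prod fun i e => a' i ^ e) ∈ orderIdeal τ (k + 1) := by
  classical
  have hne : μ ≠ 0 := by rintro rfl; simp at hμ
  obtain ⟨i, hi⟩ := Finsupp.ne_iff.1 hne
  have hle : Finsupp.single i 1 ≤ μ := by
    rw [Finsupp.single_le_iff]
    exact Nat.one_le_iff_ne_zero.2 hi
  obtain ⟨ν, rfl⟩ := exists_add_of_le hle
  rw [map_add, Finsupp.degree_single] at hμ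
  have hsplit : ∀ a : σ → MvPowerSeries τ ℝ,
      ((Finsupp.single i 1 + ν).prod fun i e => a i ^ e) = a i * ν.prod fun i e => a i ^ e := by
    intro a
    rw [Finsupp.prod_add_index' (by simp) (by simp [pow_add]), Finsupp.prod_single_index (by simp),
      pow_one]
  rw [hsplit, hsplit]
  have e : a i * (ν.prod fun i e => a i ^ e) - a' i * (ν.prod fun i e => a' i ^ e) =
      (a i - a' i) * (ν.prod fun i e => a' i ^ e) +
        ((ν.prod fun i e => a i ^ e) - (ν.prod fun i e => a' i ^ e)) * a i := by ring
  rw [e]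
  refine Ideal.add_mem _ (mul_mem_orderIdeal (h i) ?_)
    (mul_mem_orderIdeal (monomial_sub_mem h ν) (ha i))
  exact orderIdeal_anti (by omega) (monomial_mem ha' ν)

variable [Finite σ]

lemma hasSubst_of_mem (ha : ∀ i, a i ∈ orderIdeal τ 1) : MvPowerSeries.HasSubst a :=
  MvPowerSeries.hasSubst_of_constantCoeff_zero fun i => mem_orderIdeal_one.1 (ha i)

lemma subst_sub_mem_of_forall (ha : ∀ i, a i ∈ orderIdeal τ 1) (ha' : ∀ i, a' i ∈ orderIdeal τ 1)
    {K : ℕ} (p : MvPowerSeries σ ℝ)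
    (h : ∀ μ, MvPowerSeries.coeff μ p = 0 ∨
      (μ.prod fun i e => a i ^ e) - (μ.prod fun i e => a' i ^ e) ∈ orderIdeal τ K) :
    MvPowerSeries.subst a p - MvPowerSeries.subst a' p ∈ orderIdeal τ K := by
  intro n hn
  rw [map_sub, sub_eq_zero, MvPowerSeries.coeff_subst (hasSubst_of_mem ha),
    MvPowerSeries.coeff_subst (hasSubst_of_mem ha')]
  refine finsum_congr fun μ => ?_
  rcases h μ with h | h
  · rw [h, zero_smul, zero_smul]
  · rw [coeff_eq_of_sub_mem h hn]

lemma subst_sub_mem (ha : ∀ i, a i ∈ orderIdeal τ 1) (ha' : ∀ i, a' i ∈ orderIdeal τ 1)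
    {k : ℕ} (h : ∀ i, a i - a' i ∈ orderIdeal τ k) (p : MvPowerSeries σ ℝ) :
    MvPowerSeries.subst a p - MvPowerSeries.subst a' p ∈ orderIdeal τ k :=
  subst_sub_mem_of_forall ha ha' p fun μ => Or.inr (monomial_sub_mem h μ)

/-- The contraction estimate. Constant terms cancel and monomials of degree at least two gain an
order, so only linear monomials could obstruct; `hp` excludes them. -/
lemma subst_sub_mem_succ (ha : ∀ i, a i ∈ orderIdeal τ 1) (ha' : ∀ i, a' i ∈ orderIdeal τ 1)
    {k : ℕ} (h : ∀ i, a i - a' i ∈ orderIdeal τ k) (p : MvPowerSeries σ ℝ)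
    (hp : ∀ i, MvPowerSeries.coeff (Finsupp.single i 1) p = 0 ∨ a i = a' i) :
    MvPowerSeries.subst a p - MvPowerSeries.subst a' p ∈ orderIdeal τ (k + 1) := by
  refine subst_sub_mem_of_forall ha ha' p fun μ => ?_
  rcases Nat.lt_or_ge μ.degree 2 with hμ | hμ
  · rcases (show μ.degree = 0 ∨ μ.degree = 1 by omega) with h0 | h1
    · obtain rfl := (Finsupp.degree_eq_zero_iff μ).1 h0
      right
      simp
    · obtain ⟨i, rfl⟩ := exists_eq_single_of_degree_eq_one h1
      refine (hp i).imp_right fun h => ?_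
      simp [h]
  · exact Or.inr (monomial_sub_mem_succ ha ha' h hμ)

lemma constantCoeff_subst_of_mem (ha : ∀ i, a i ∈ orderIdeal τ 1) (p : MvPowerSeries σ ℝ) :
    MvPowerSeries.constantCoeff (MvPowerSeries.subst a p) = MvPowerSeries.constantCoeff p := by
  rw [MvPowerSeries.constantCoeff_subst (hasSubst_of_mem ha), finsum_eq_single _ 0]
  · simp
  · intro μ hμ
    have h : 1 ≤ μ.degree := by
      rw [Nat.one_le_iff_ne_zero, Ne, Finsupp.degree_eq_zero_iff]
      exact hμ
    rw [mem_orderIdeal_one.1 (orderIdeal_anti h (monomial_mem ha μ)), smul_zero]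

/-- Modulo terms of order `N`, only the monomials of degree less than `N` matter in a
substitution. -/
lemma subst_sub_sum_mem (ha : ∀ i, a i ∈ orderIdeal τ 1) (p : MvPowerSeries σ ℝ) {N : ℕ}
    {s : Finset (σ →₀ ℕ)} (hs : ∀ μ : σ →₀ ℕ, μ.degree < N → μ ∈ s) :
    MvPowerSeries.subst a p -
      ∑ μ ∈ s, MvPowerSeries.coeff μ p • (μ.prod fun i e => a i ^ e) ∈ orderIdeal τ N := by
  intro n hn
  rw [map_sub, sub_eq_zero, MvPowerSeries.coeff_subst (hasSubst_of_mem ha), map_sum,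
    finsum_eq_sum_of_support_subset (s := s)]
  · simp
  · intro μ hμ
    refine hs μ ?_
    by_contra hcon
    refine hμ ?_
    simp only
    rw [monomial_mem ha μ n (by omega), smul_zero]

end Order

/-! ### Fixed points -/

/-- Banach's fixed point theorem for the filtration by order: each application of `Φ` improves
agreement by one order, and formal power series are complete. -/
theorem existsUnique_fixedPoint {τ : Type} {d : ℕ}
    (Φ : (Fin d → MvPowerSeries τ ℝ) → Fin d → MvPowerSeries τ ℝ)
    (h0 : ∀ q, (∀ i, q i ∈ orderIdeal τ 1) → ∀ i, Φ q i ∈ orderIdeal τ 1)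
    (hΦ : ∀ k q q', (∀ i, q i ∈ orderIdeal τ 1) → (∀ i, q' i ∈ orderIdeal τ 1) →
      (∀ i, q i - q' i ∈ orderIdeal τ k) → ∀ i, Φ q i - Φ q' i ∈ orderIdeal τ (k + 1)) :
    ∃ q, (∀ i, q i ∈ orderIdeal τ 1) ∧ Φ q = q ∧
      ∀ q', (∀ i, q' i ∈ orderIdeal τ 1) → Φ q' = q' → q' = q := by
  let it : ℕ → Fin d → MvPowerSeries τ ℝ := fun k => Φ^[k] 0
  have it_succ : ∀ k, it (k + 1) = Φ (it k) := fun k => Function.iterate_succ_apply' Φ k 0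
  have it_mem : ∀ k i, it k i ∈ orderIdeal τ 1 := by
    intro k
    induction k with
    | zero => exact fun i => Ideal.zero_mem _
    | succ k ih => rw [it_succ]; exact h0 _ ih
  have it_step : ∀ k i, it (k + 1) i - it k i ∈ orderIdeal τ k := by
    intro k
    induction k with
    | zero => exact fun i => mem_orderIdeal_zero _
    | succ k ih =>
      intro i
      have := hΦ k _ _ (it_mem (k + 1)) (it_mem k) ih i
      rwa [← it_succ, ← it_succ] at this
  have it_add : ∀ k m i, it (k + m) i - it k i ∈ orderIdeal τ k := by
    intro k m i
    induction m with
    | zero => simp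
    | succ m ih =>
      have := Ideal.add_mem _ (orderIdeal_anti (Nat.le_add_right k m) (it_step (k + m) i)) ih
      rwa [sub_add_sub_cancel] at this
  -- The iterates from number `k` on agree below order `k`, so the coefficient at `n` is stable from
  -- iterate `n.degree + 1`.
  let q : Fin d → MvPowerSeries τ ℝ := fun i n => MvPowerSeries.coeff n (it (n.degree + 1) i)
  have q_sub : ∀ k i, q i - it k i ∈ orderIdeal τ k := by
    intro k i n hn
    rw [map_sub, sub_eq_zero]
    obtain ⟨m, rfl⟩ : ∃ m, k = n.degree + 1 + m := ⟨k - (n.degree + 1), by omega⟩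
    exact (coeff_eq_of_sub_mem (it_add (n.degree + 1) m i) (by omega)).symm
  have q_mem : ∀ i, q i ∈ orderIdeal τ 1 := fun i => by
    have := Ideal.add_mem _ (q_sub 1 i) (it_mem 1 i)
    rwa [sub_add_cancel] at this
  refine ⟨q, q_mem, ?_, ?_⟩
  · funext i
    refine eq_of_forall_sub_mem fun N => ?_
    have h1 := hΦ N q (it N) q_mem (it_mem N) (q_sub N) i
    rw [← it_succ] at h1
    have h2 := Ideal.sub_mem _ h1 (q_sub (N + 1) i)
    rw [sub_sub_sub_cancel_right] at h2
    exact orderIdeal_anti (Nat.le_succ N) h2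
  · intro q' hq' hfix
    have hfixq : ∀ k i, q' i - it k i ∈ orderIdeal τ k := by
      intro k
      induction k with
      | zero => exact fun i => mem_orderIdeal_zero _
      | succ k ih =>
        intro i
        have := hΦ k q' (it k) hq' (it_mem k) ih i
        rwa [hfix, ← it_succ] at this
    funext i
    refine eq_of_forall_sub_mem fun N => ?_
    have := Ideal.sub_mem _ (hfixq N i) (q_sub N i)
    rwa [sub_sub_sub_cancel_right] at this

/-! ### Iterated partial derivatives -/

section Partials

open Filter Topology

variable {d : ℕ} {h h' : (Fin d → ℝ) → ℝ} {c : Fin d → ℝ}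

/-- The partial derivative of a function in direction `α`. -/
def pdiff (α : Fin d) (h : (Fin d → ℝ) → ℝ) (y : Fin d → ℝ) : ℝ := fderiv ℝ h y (Pi.single α 1)

lemma contDiffAt_pdiff (hh : ContDiffAt ℝ ∞ h c) (α : Fin d) : ContDiffAt ℝ ∞ (pdiff α h) c :=
  (hh.fderiv_right (m := ∞) (by simp)).clm_apply contDiffAt_const

/-- The last index belongs to the innermost derivative, which is why `partials_eq_listDiff` reads
the tuple backwards. -/
lemma partials_succ (hh : ContDiffAt ℝ ∞ h c) {k : ℕ} (t : Fin (k + 1) → Fin d) :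
    partials t h c = partials (Fin.init t) (pdiff (t (Fin.last k)) h) c := by
  rw [partials, iteratedFDeriv_succ_apply_right, partials]
  have hf : ContDiffAt ℝ ∞ (fun y => fderiv ℝ h y) c := hh.fderiv_right (m := ∞) (by simp)
  have := (ContinuousLinearMap.apply ℝ ℝ
    (Pi.single (t (Fin.last k)) 1 : Fin d → ℝ)).iteratedFDeriv_comp_left hf (i := k)
      (mod_cast le_top)
  have h2 : pdiff (t (Fin.last k)) h = (ContinuousLinearMap.apply ℝ ℝ
    (Pi.single (t (Fin.last k)) 1 : Fin d → ℝ)) ∘ fun y => fderiv ℝ h y := rfl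
  rw [h2, this]
  rfl

lemma pdiff_congr (hh : h =ᶠ[𝓝 c] h') (α : Fin d) : pdiff α h =ᶠ[𝓝 c] pdiff α h' := by
  filter_upwards [hh.fderiv (𝕜 := ℝ)] with y hy
  simp [pdiff, hy]

/-- Symmetry of the second derivative, on a neighbourhood and not only at `c`, since further
derivatives will be applied. -/
lemma pdiff_comm (hh : ContDiffAt ℝ ∞ h c) (α β : Fin d) :
    pdiff α (pdiff β h) =ᶠ[𝓝 c] pdiff β (pdiff α h) := by
  have h2 : ContDiffAt ℝ 2 h c := contDiffAt_infty.1 hh 2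
  filter_upwards [h2.eventually (by simp)] with y hy
  have hd : DifferentiableAt ℝ (fderiv ℝ h) y :=
    (hy.fderiv_right (m := 1) (by norm_num)).differentiableAt (by simp)
  have hs := hy.isSymmSndFDerivAt (by simp)
  have key : ∀ α β : Fin d, pdiff α (pdiff β h) y =
      fderiv ℝ (fderiv ℝ h) y (Pi.single α 1) (Pi.single β 1) := by
    intro α β
    rw [pdiff]
    have : fderiv ℝ (pdiff β h) y = (fderiv ℝ (fderiv ℝ h) y).flip (Pi.single β 1) := by
      have := hd.hasFDerivAt.clm_apply (hasFDerivAt_const (Pi.single β 1 : Fin d → ℝ) y)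
      rw [show pdiff β h = fun y => fderiv ℝ h y (Pi.single β 1) from rfl, this.fderiv]
      simp
    rw [this]
    rfl
  rw [key, key, hs.eq]

/-- The iterated partial derivative with indices in a list. -/
def listDiff (l : List (Fin d)) (h : (Fin d → ℝ) → ℝ) : (Fin d → ℝ) → ℝ :=
  l.foldl (fun h α => pdiff α h) h

lemma listDiff_congr (l : List (Fin d)) (hh : h =ᶠ[𝓝 c] h') : listDiff l h c = listDiff l h' c := by
  induction l generalizing h h' with
  | nil => exact hh.eq_of_nhds
  | cons α l ih => exact ih (pdiff_congr hh α)

lemma listDiff_perm {l l' : List (Fin d)} (hl : l.Perm l') (hh : ContDiffAt ℝ ∞ h c) :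
    listDiff l h c = listDiff l' h c := by
  induction hl generalizing h with
  | nil => rfl
  | cons α _ ih => exact ih (contDiffAt_pdiff hh α)
  | swap α β l => exact listDiff_congr l (pdiff_comm hh α β)
  | trans _ _ ih1 ih2 => exact (ih1 hh).trans (ih2 hh)

lemma partials_eq_listDiff (hh : ContDiffAt ℝ ∞ h c) {k : ℕ} (t : Fin k → Fin d) :
    partials t h c = listDiff (List.ofFn t).reverse h c := by
  induction k generalizing h with
  | zero => simp [partials, listDiff]
  | succ k ih =>
    rw [partials_succ hh, ih (contDiffAt_pdiff hh _), List.ofFn_succ', List.concat_eq_append,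
      List.reverse_append]
    rfl

lemma partials_comp_perm (hh : ContDiffAt ℝ ∞ h c) {k : ℕ} (t : Fin k → Fin d)
    (σ : Equiv.Perm (Fin k)) : partials (t ∘ σ) h c = partials t h c := by
  rw [partials_eq_listDiff hh, partials_eq_listDiff hh]
  exact listDiff_perm ((List.reverse_perm _).trans
    ((Equiv.Perm.ofFn_comp_perm σ t).trans (List.reverse_perm _).symm)) hh

lemma partials_congr_content (hh : ContDiffAt ℝ ∞ h c) {k : ℕ} {t t' : Fin k → Fin d}
    (ht : content t = content t') : partials t h c = partials t' h c := by
  obtain ⟨σ, rfl⟩ := exists_perm_of_content_eq ht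
  exact partials_comp_perm hh t' σ

end Partials

/-! ### Coefficients of tensor series and Taylor series -/

section Coefficients

variable {d : ℕ}

/-- By `hT` all `k! / μ!` tuples of content `μ` contribute equally. For `F` this explains the factor
`m_v!` at a black vertex; for a Taylor series it cancels the `1 / k!`. -/
lemma coeff_tensorSeries (T : ∀ k : ℕ, (Fin k → Fin d) → ℝ)
    (hT : ∀ k (t t' : Fin k → Fin d), content t = content t' → T k t = T k t')
    {k : ℕ} (t : Fin k → Fin d) :
    multiFactorial (content t) * MvPowerSeries.coeff (content t) (tensorSeries T) =
      k.factorial * T k t := by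
  classical
  obtain ⟨μ, hμ⟩ : ∃ μ, content t = μ := ⟨_, rfl⟩
  have hk := degree_content t
  rw [hμ] at hk ⊢
  subst hk
  have h1 : MvPowerSeries.coeff μ (tensorSeries T) =
      ((Finset.univ.filter fun t' : Fin μ.degree → Fin d => content t' = μ).card : ℝ) *
        T _ t := by
    rw [← nsmul_eq_mul, ← Finset.sum_const]
    change (∑ a : Fin μ.degree → Fin d with ∑ k, Finsupp.single (a k) 1 = μ, T μ.degree a) = _
    refine Finset.sum_congr (Finset.ext fun a => by rw [Finset.mem_filter, Finset.mem_filter]; rfl) fun t' ht' => hT _ _ _ ?_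
    rw [hμ]
    exact (Finset.mem_filter.1 ht').2
  rw [h1, ← mul_assoc, mul_comm (multiFactorial μ), card_content_eq _ μ rfl]

/-- The Taylor coefficients `∂^μ h (c)`, without factorials. -/
def taylorCoeff (h : (Fin d → ℝ) → ℝ) (c : Fin d → ℝ) (μ : Fin d →₀ ℕ) : ℝ :=
  multiFactorial μ * MvPowerSeries.coeff μ (taylorSeries h c)

variable {h : (Fin d → ℝ) → ℝ} {c : Fin d → ℝ}

lemma taylorCoeff_content (hh : ContDiffAt ℝ ∞ h c) {k : ℕ} (t : Fin k → Fin d) :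
    taylorCoeff h c (content t) = partials t h c := by
  rw [taylorCoeff, taylorSeries, coeff_tensorSeries]
  · exact mul_inv_cancel_left₀ (Nat.cast_ne_zero.2 (Nat.factorial_ne_zero k)) _
  · intro k t t' ht
    rw [partials_congr_content hh ht]

lemma taylorCoeff_pdiff (hh : ContDiffAt ℝ ∞ h c) (α : Fin d) (μ : Fin d →₀ ℕ) :
    taylorCoeff (pdiff α h) c μ = taylorCoeff h c (μ + Finsupp.single α 1) := by
  obtain ⟨t, ht⟩ := exists_content_eq μ
  have h1 : content (Fin.snoc (α := fun _ => Fin d) t α) = μ + Finsupp.single α 1 := by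
    rw [content, Fin.sum_univ_castSucc]
    simp only [Fin.snoc_castSucc, Fin.snoc_last]
    rw [show ∑ j, Finsupp.single (t j) 1 = content t from rfl, ht]
  conv_lhs => rw [← ht]
  rw [taylorCoeff_content (contDiffAt_pdiff hh α), ← h1, taylorCoeff_content hh, partials_succ hh]
  simp

lemma taylorCoeff_sum {ι : Type*} (s : Finset ι) (f : ι → (Fin d → ℝ) → ℝ)
    (hf : ∀ i ∈ s, ContDiffAt ℝ ∞ (f i) c) (μ : Fin d →₀ ℕ) :
    taylorCoeff (fun y => ∑ i ∈ s, f i y) c μ = ∑ i ∈ s, taylorCoeff (f i) c μ := by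
  obtain ⟨t, ht⟩ := exists_content_eq μ
  rw [← ht, taylorCoeff_content (ContDiffAt.sum hf),
    Finset.sum_congr rfl fun i hi => taylorCoeff_content (hf i hi) t]
  simp only [partials]
  rw [iteratedFDeriv_fun_sum_apply fun i hi => (hf i hi).of_le (by exact_mod_cast le_top),
    sum_apply]

lemma taylorCoeff_eq_zero_of_fderiv (hh : ContDiffAt ℝ ∞ h c) (h1 : fderiv ℝ h c = 0)
    (h2 : fderiv ℝ (fderiv ℝ h) c = 0) {μ : Fin d →₀ ℕ} (hμ : μ.degree = 1 ∨ μ.degree = 2) :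
    taylorCoeff h c μ = 0 := by
  obtain ⟨t, ht⟩ := exists_content_eq μ
  rw [← ht, taylorCoeff_content hh, partials]
  clear ht
  generalize μ.degree = k at *
  rcases hμ with rfl | rfl
  · rw [iteratedFDeriv_one_apply, h1]
    rfl
  · rw [iteratedFDeriv_two_apply, h2]
    rfl

end Coefficients

/-! ### Shifts and substitutions -/

section Substitution

variable {d d₃ : ℕ} {τ : Type}

/-- The coefficient of a series, multiplied by the factorial of its multi-index. -/
def seriesCoeff (p : MvPowerSeries (Fin d) ℝ) (μ : Fin d →₀ ℕ) : ℝ :=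
  multiFactorial μ * MvPowerSeries.coeff μ p

lemma seriesCoeff_pderiv (p : MvPowerSeries (Fin d) ℝ) (i : Fin d) (μ : Fin d →₀ ℕ) :
    seriesCoeff (MvPowerSeries.pderiv ℝ i p) μ = seriesCoeff p (Finsupp.single i 1 + μ) := by
  rw [seriesCoeff, seriesCoeff, MvPowerSeries.coeff_pderiv, add_comm (Finsupp.single i 1) μ,
    multiFactorial_add_single]
  ring

lemma map_translate {R R' : Type*} [CommRing R] [Algebra ℝ R] [CommRing R'] [Algebra ℝ R']
    (f : R →ₐ[ℝ] R') (N : ℕ) (a : Fin d → R) (β : (Fin d →₀ ℕ) → R) (μ : Fin d →₀ ℕ) :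
    f (translate N a β μ) = translate N (fun i => f (a i)) (fun μ => f (β μ)) μ := by
  simp [translate_eq, map_sum, map_smul, map_mul, map_pow]

/-- Used with `μ₀ = 0` and `p' = p` for the value of a series at `q`, and with `μ₀` a unit vector
and `p'` a partial derivative for its gradient. -/
lemma subst_sub_translate_mem {q : Fin d → MvPowerSeries τ ℝ} (hq : ∀ i, q i ∈ orderIdeal τ 1)
    {p p' : MvPowerSeries (Fin d) ℝ} {μ₀ : Fin d →₀ ℕ}
    (h : ∀ μ, seriesCoeff p' μ = seriesCoeff p (μ₀ + μ)) (N : ℕ) :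
    MvPowerSeries.subst q p' - translate N q
      (fun μ => algebraMap ℝ (MvPowerSeries τ ℝ) (seriesCoeff p μ)) μ₀ ∈ orderIdeal τ N := by
  have h1 := subst_sub_sum_mem hq p' (N := N) (s := degreeLT d N) fun μ hμ => mem_degreeLT.2 hμ
  convert h1 using 2
  rw [translate_eq]
  refine Finset.sum_congr rfl fun μ _ => ?_
  rw [← h, mul_comm, ← Algebra.smul_def, smul_smul, seriesCoeff,
    inv_mul_cancel_left₀ (multiFactorial_ne_zero μ)]

/-- The factor of a white vertex of weight `ℓ` whose edges have multi-index `μ`. -/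
def whiteFactor (g : ∀ ℓ : ℕ, (Fin ℓ → Fin d₃) → (Fin d → ℝ) → ℝ) (s : MvPowerSeries τ ℝ)
    (ρ : Fin d₃ → MvPowerSeries τ ℝ) (c : Fin d → ℝ) (ℓ : ℕ) (μ : Fin d →₀ ℕ) :
    MvPowerSeries τ ℝ :=
  s * ∑ a : Fin ℓ → Fin d₃, taylorCoeff (g ℓ a) c μ • ∏ k, ρ (a k)

lemma whiteFactor_mem {g : ∀ ℓ : ℕ, (Fin ℓ → Fin d₃) → (Fin d → ℝ) → ℝ} {s : MvPowerSeries τ ℝ}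
    {ρ : Fin d₃ → MvPowerSeries τ ℝ} (hρ : ∀ j, ρ j ∈ orderIdeal τ 1) (c : Fin d → ℝ) (ℓ : ℕ)
    (μ : Fin d →₀ ℕ) : whiteFactor g s ρ c ℓ μ ∈ orderIdeal τ ℓ := by
  refine Ideal.mul_mem_left _ _ (Submodule.sum_mem _ fun a _ => ?_)
  refine Submodule.smul_of_tower_mem _ _ (orderIdeal_one_pow_le ℓ ?_)
  simpa using prod_mem_pow_card (orderIdeal τ 1) Finset.univ (fun k => ρ (a k))
    (fun _ => True) fun k _ _ => hρ _

-- The counterpart for the white function, again with `μ₀ = 0` for `G` and a unit vector for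
-- `∂G/∂y`. Monomials in `r` are regrouped by weight.
open Classical in
lemma subst_sub_translate_whiteFactor_mem {η : Fin d → MvPowerSeries τ ℝ}
    (hη : ∀ i, η i ∈ orderIdeal τ 1) {ρ : Fin d₃ → MvPowerSeries τ ℝ}
    (hρ : ∀ j, ρ j ∈ orderIdeal τ 1) (s : MvPowerSeries τ ℝ)
    {g : ∀ ℓ : ℕ, (Fin ℓ → Fin d₃) → (Fin d → ℝ) → ℝ} {c : Fin d → ℝ}
    {P : MvPowerSeries (Fin d ⊕ Fin d₃) ℝ} {μ₀ : Fin d →₀ ℕ}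
    (hP : ∀ μ ν, multiFactorial μ *
      MvPowerSeries.coeff (Finsupp.sumFinsuppEquivProdFinsupp.symm (μ, ν)) P =
      ∑ a : Fin ν.degree → Fin d₃ with content a = ν, taylorCoeff (g _ a) c (μ₀ + μ)) (N : ℕ) :
    s * MvPowerSeries.subst (Sum.elim η ρ) P - translate N η
      (fun μ => ∑ ℓ ∈ Finset.range N, whiteFactor g s ρ c ℓ μ) μ₀ ∈ orderIdeal τ N := by
  -- A box in the two multi-indices rather than a bound on the total degree: it contains all
  -- monomials of degree less than `N`, and the sum over it factors.
  let D : Finset ((Fin d ⊕ Fin d₃) →₀ ℕ) := (degreeLT d N ×ˢ degreeLT d₃ N).map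
    Finsupp.sumFinsuppEquivProdFinsupp.symm.toEmbedding
  have hD : ∀ K : (Fin d ⊕ Fin d₃) →₀ ℕ, K.degree < N → K ∈ D := by
    intro K hK
    obtain ⟨⟨μ, ν⟩, rfl⟩ := Finsupp.sumFinsuppEquivProdFinsupp.symm.surjective K
    have hdeg : (Finsupp.sumFinsuppEquivProdFinsupp.symm (μ, ν)).degree =
        μ.degree + ν.degree := by
      simp [Finsupp.degree_eq_sum]
    rw [hdeg] at hK
    refine Finset.mem_map.2 ⟨(μ, ν), ?_, rfl⟩
    rw [Finset.mem_product, mem_degreeLT, mem_degreeLT]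
    exact ⟨by simp only; omega, by simp only; omega⟩
  have hel : ∀ i, Sum.elim η ρ i ∈ orderIdeal τ 1 := by
    rintro (i | j)
    exacts [hη i, hρ j]
  have h1 := Ideal.mul_mem_left _ s (subst_sub_sum_mem hel P hD)
  convert h1 using 1
  rw [mul_sub]
  congr 1
  rw [translate_eq, Finset.sum_map, Finset.sum_product, Finset.mul_sum]
  refine Finset.sum_congr rfl fun μ _ => ?_
  simp only [whiteFactor]
  rw [← Finset.mul_sum, sum_tuples N fun ℓ a => taylorCoeff (g ℓ a) c (μ₀ + μ) • ∏ k, ρ (a k),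
    mul_left_comm, ← mul_smul_comm]
  congr 1
  rw [Finset.mul_sum, Finset.smul_sum]
  refine Finset.sum_congr rfl fun ν _ => ?_
  have h2 : ∑ a : Fin ν.degree → Fin d₃ with content a = ν,
      taylorCoeff (g _ a) c (μ₀ + μ) • ∏ k, ρ (a k) =
      (∑ a : Fin ν.degree → Fin d₃ with content a = ν, taylorCoeff (g _ a) c (μ₀ + μ)) •
        ν.prod fun i e => ρ i ^ e := by
    rw [Finset.sum_smul]
    refine Finset.sum_congr rfl fun a ha => ?_
    rw [← prod_content, (Finset.mem_filter.1 ha).2]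
  rw [h2, ← hP, mul_smul_comm, smul_smul, inv_mul_cancel_left₀ (multiFactorial_ne_zero μ)]
  congr 1
  rw [Finsupp.prod_fintype _ _ (by simp), Finsupp.prod_fintype _ _ (by simp),
    Finsupp.prod_fintype _ _ (by simp), Fintype.prod_sum_type]
  simp

end Substitution

/-! ### The equations for `ȳ` and `q̄`, expanded at `φ(x)` -/

section Solution

variable {d₁ d₂ d₃ : ℕ} {U : Set (Fin d₁ → ℝ)} {V : Set (Fin d₂ → ℝ)} {τ : Type}

open Classical in
lemma coeff_series (G : GeneratingFunction V d₃) (y : Fin d₂ → ℝ) (ν : Fin d₃ →₀ ℕ) :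
    MvPowerSeries.coeff ν (G.series y) =
      ∑ a : Fin ν.degree → Fin d₃ with content a = ν, G.coeff _ a y := by
  change (∑ a : Fin ν.degree → Fin d₃ with ∑ k, Finsupp.single (a k) 1 = ν, G.coeff ν.degree a y)
    = _
  exact Finset.sum_congr
    (Finset.ext fun a => by rw [Finset.mem_filter, Finset.mem_filter]; rfl) fun _ _ => rfl

variable {G : GeneratingFunction V d₃} {c : Fin d₂ → ℝ}
  (hG : ∀ ℓ a, ContDiffAt ℝ ∞ (G.coeff ℓ a) c)

include hG

open Classical in
lemma coeff_jointTaylor (μ : Fin d₂ →₀ ℕ) (ν : Fin d₃ →₀ ℕ) : multiFactorial μ *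
    MvPowerSeries.coeff (Finsupp.sumFinsuppEquivProdFinsupp.symm (μ, ν))
      (jointTaylor G.series c) =
    ∑ a : Fin ν.degree → Fin d₃ with content a = ν, taylorCoeff (G.coeff _ a) c (0 + μ) := by
  have h1 : MvPowerSeries.coeff (Finsupp.sumFinsuppEquivProdFinsupp.symm (μ, ν))
      (jointTaylor G.series c) =
      MvPowerSeries.coeff μ (taylorSeries (fun y => MvPowerSeries.coeff ν (G.series y)) c) := by
    change MvPowerSeries.coeff (Finsupp.sumFinsuppEquivProdFinsupp
      (Finsupp.sumFinsuppEquivProdFinsupp.symm (μ, ν))).1 (taylorSeries (fun y =>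
        MvPowerSeries.coeff (Finsupp.sumFinsuppEquivProdFinsupp
          (Finsupp.sumFinsuppEquivProdFinsupp.symm (μ, ν))).2 (G.series y)) c) = _
    rw [Equiv.apply_symm_apply]
  rw [h1, ← taylorCoeff, zero_add]
  simp only [coeff_series]
  rw [taylorCoeff_sum _ _ fun a _ => hG _ a]

open Classical in
lemma coeff_jointTaylor_partialY (α : Fin d₂) (μ : Fin d₂ →₀ ℕ) (ν : Fin d₃ →₀ ℕ) :
    multiFactorial μ * MvPowerSeries.coeff (Finsupp.sumFinsuppEquivProdFinsupp.symm (μ, ν))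
      (jointTaylor (partialY α G.series) c) =
    ∑ a : Fin ν.degree → Fin d₃ with content a = ν,
      taylorCoeff (G.coeff _ a) c (Finsupp.single α 1 + μ) := by
  have h1 : MvPowerSeries.coeff (Finsupp.sumFinsuppEquivProdFinsupp.symm (μ, ν))
      (jointTaylor (partialY α G.series) c) = MvPowerSeries.coeff μ
        (taylorSeries (pdiff α fun y => MvPowerSeries.coeff ν (G.series y)) c) := by
    change MvPowerSeries.coeff (Finsupp.sumFinsuppEquivProdFinsupp
      (Finsupp.sumFinsuppEquivProdFinsupp.symm (μ, ν))).1 (taylorSeries (pdiff α fun y =>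
        MvPowerSeries.coeff (Finsupp.sumFinsuppEquivProdFinsupp
          (Finsupp.sumFinsuppEquivProdFinsupp.symm (μ, ν))).2 (G.series y)) c) = _
    rw [Equiv.apply_symm_apply]
  rw [h1, ← taylorCoeff]
  simp only [coeff_series]
  rw [taylorCoeff_pdiff (ContDiffAt.sum fun a _ => hG _ a), taylorCoeff_sum _ _ fun a _ => hG _ a,
    add_comm]

lemma taylorCoeff_zeroth_eq_zero (h1 : fderiv ℝ G.zeroth c = 0)
    (h2 : fderiv ℝ (fderiv ℝ G.zeroth) c = 0) (a : Fin 0 → Fin d₃) {μ : Fin d₂ →₀ ℕ}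
    (hμ : μ.degree = 1 ∨ μ.degree = 2) : taylorCoeff (G.coeff 0 a) c μ = 0 := by
  have h : G.coeff 0 a = G.zeroth := by
    funext y
    rw [GeneratingFunction.zeroth, Subsingleton.elim a Fin.elim0]
  have hsm := hG 0 a
  rw [h] at hsm ⊢
  exact taylorCoeff_eq_zero_of_fderiv hsm h1 h2 hμ

variable {s : MvPowerSeries τ ℝ} {ρ : Fin d₃ → MvPowerSeries τ ℝ}
  (hρ : ∀ j, ρ j ∈ orderIdeal τ 1)
  (hs : s ∈ orderIdeal τ 1 ∨ fderiv ℝ G.zeroth c = 0 ∧ fderiv ℝ (fderiv ℝ G.zeroth) c = 0)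

include hs

/-- At `r = 0` these coefficients are first and second derivatives of `G₀`, up to factorials. Degree
zero serves to show that `q̄` has no constant term, degree one to show that the equation contracts.
-/
lemma coeff_jointTaylor_partialY_eq_zero (α : Fin d₂) {μ : Fin d₂ →₀ ℕ} (hμ : μ.degree ≤ 1) :
    s ∈ orderIdeal τ 1 ∨ MvPowerSeries.coeff (Finsupp.sumFinsuppEquivProdFinsupp.symm (μ, 0))
      (jointTaylor (partialY α G.series) c) = 0 := by
  classical
  refine hs.imp_right fun h => ?_
  have key := coeff_jointTaylor_partialY hG α μ 0
  rw [Finset.sum_eq_zero] at key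
  · exact (mul_eq_zero.1 key).resolve_left (multiFactorial_ne_zero μ)
  · intro a _
    have : ∀ k, k = 0 → ∀ a : Fin k → Fin d₃,
        taylorCoeff (G.coeff k a) c (Finsupp.single α 1 + μ) = 0 := by
      rintro k rfl a
      refine taylorCoeff_zeroth_eq_zero hG h.1 h.2 a ?_
      rw [map_add, Finsupp.degree_single]
      omega
    exact this _ (by simp) a

include hρ

/-- Without a small `s`, weight zero gives derivatives of `G₀`, which vanish, and positive weight
gives a factor `ρ`. -/
lemma whiteFactor_mem_one (ℓ : ℕ) {μ : Fin d₂ →₀ ℕ} (hμ : μ.degree = 1 ∨ μ.degree = 2) :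
    whiteFactor G.coeff s ρ c ℓ μ ∈ orderIdeal τ 1 := by
  rcases hs with hs | ⟨h1, h2⟩
  · exact Ideal.mul_mem_right _ _ hs
  · rcases ℓ with _ | ℓ
    · rw [whiteFactor, Finset.sum_eq_zero, mul_zero]
      · exact Ideal.zero_mem _
      · intro a _
        rw [taylorCoeff_zeroth_eq_zero hG h1 h2 a hμ, zero_smul]
    · exact orderIdeal_anti (by omega) (whiteFactor_mem hρ c (ℓ + 1) μ)

omit hG hs hρ

/-- `ȳ - φ(x)` as a function of `q̄`. -/
def etaOf (F : GeneratingFunction U d₂) (x : Fin d₁ → ℝ) (q : Fin d₂ → MvPowerSeries τ ℝ)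
    (α : Fin d₂) : MvPowerSeries τ ℝ :=
  MvPowerSeries.subst q (MvPowerSeries.pderiv ℝ α (F.series x)) - MvPowerSeries.C (F.phi x α)

lemma coeff_series_single (F : GeneratingFunction U d₂) (x : Fin d₁ → ℝ) (α : Fin d₂) :
    MvPowerSeries.coeff (Finsupp.single α 1) (F.series x) = F.phi x α := by
  classical
  rw [coeff_series]
  have hd : (Finsupp.single α 1 : Fin d₂ →₀ ℕ).degree = 1 := by simp
  have key : ∀ k, k = 1 → ∑ a : Fin k → Fin d₂ with content a = Finsupp.single α 1,
      F.coeff k a x = F.phi x α := by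
    rintro k rfl
    rw [Finset.sum_eq_single_of_mem (fun _ => α) (by simp [content])]
    · rfl
    · intro a ha hne
      refine absurd ?_ hne
      funext k
      have h := (Finset.mem_filter.1 ha).2
      rw [content, Fin.sum_univ_one] at h
      rw [Subsingleton.elim k 0]
      exact Finsupp.single_left_injective one_ne_zero h
  exact key _ hd

lemma constantCoeff_subst_pderiv (F : GeneratingFunction U d₂) (x : Fin d₁ → ℝ)
    {q : Fin d₂ → MvPowerSeries τ ℝ} (hq : ∀ i, q i ∈ orderIdeal τ 1) (α : Fin d₂) :
    MvPowerSeries.constantCoeff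
      (MvPowerSeries.subst q (MvPowerSeries.pderiv ℝ α (F.series x))) = F.phi x α := by
  rw [constantCoeff_subst_of_mem hq, ← MvPowerSeries.coeff_zero_eq_constantCoeff_apply,
    MvPowerSeries.coeff_pderiv, zero_add, coeff_series_single]
  simp

lemma etaOf_mem (F : GeneratingFunction U d₂) (x : Fin d₁ → ℝ)
    {q : Fin d₂ → MvPowerSeries τ ℝ} (hq : ∀ i, q i ∈ orderIdeal τ 1) (α : Fin d₂) :
    etaOf F x q α ∈ orderIdeal τ 1 := by
  rw [mem_orderIdeal_one, etaOf, map_sub, constantCoeff_subst_pderiv F x hq]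
  simp

lemma evalAt_eq (F : GeneratingFunction U d₂) (x : Fin d₁ → ℝ)
    {q : Fin d₂ → MvPowerSeries τ ℝ} (hq : ∀ i, q i ∈ orderIdeal τ 1)
    (g : (Fin d₂ → ℝ) → MvPowerSeries (Fin d₃) ℝ) (ρ : Fin d₃ → MvPowerSeries τ ℝ) :
    evalAt g (fun α => MvPowerSeries.subst q (MvPowerSeries.pderiv ℝ α (F.series x))) ρ =
      MvPowerSeries.subst (Sum.elim (etaOf F x q) ρ) (jointTaylor g (F.phi x)) := by
  simp only [evalAt, constantCoeff_subst_pderiv F x hq]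
  rfl

lemma elim_mem (F : GeneratingFunction U d₂) (x : Fin d₁ → ℝ) (hρ : ∀ j, ρ j ∈ orderIdeal τ 1)
    {q : Fin d₂ → MvPowerSeries τ ℝ} (hq : ∀ i, q i ∈ orderIdeal τ 1) (i : Fin d₂ ⊕ Fin d₃) :
    Sum.elim (etaOf F x q) ρ i ∈ orderIdeal τ 1 := by
  rcases i with i | j
  exacts [etaOf_mem F x hq i, hρ j]

lemma sumFinsuppEquivProdFinsupp_symm_single (i : Fin d₂) :
    Finsupp.sumFinsuppEquivProdFinsupp.symm (Finsupp.single i 1, (0 : Fin d₃ →₀ ℕ)) =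
      Finsupp.single (Sum.inl i) 1 := by
  ext j
  rcases j with j | j <;> simp [Finsupp.single_apply]

lemma sumFinsuppEquivProdFinsupp_symm_zero :
    Finsupp.sumFinsuppEquivProdFinsupp.symm ((0 : Fin d₂ →₀ ℕ), (0 : Fin d₃ →₀ ℕ)) = 0 := by
  ext j
  rcases j with j | j <;> simp

/-- The map of which `q̄` is the fixed point. -/
def solutionMap (F : GeneratingFunction U d₂) (G : GeneratingFunction V d₃)
    (s : MvPowerSeries τ ℝ) (ρ : Fin d₃ → MvPowerSeries τ ℝ) (x : Fin d₁ → ℝ)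
    (q : Fin d₂ → MvPowerSeries τ ℝ) (α : Fin d₂) : MvPowerSeries τ ℝ :=
  s * MvPowerSeries.subst (Sum.elim (etaOf F x q) ρ) (jointTaylor (partialY α G.series) (F.phi x))

end Solution

/-! ### Existence and uniqueness of `ȳ` and `q̄` -/

section FixedPoint

variable {d₁ d₂ d₃ : ℕ} {U : Set (Fin d₁ → ℝ)} {V : Set (Fin d₂ → ℝ)} {τ : Type}
  (F : GeneratingFunction U d₂) {G : GeneratingFunction V d₃} {x : Fin d₁ → ℝ}
  {s : MvPowerSeries τ ℝ} {ρ : Fin d₃ → MvPowerSeries τ ℝ}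
  (hG : ∀ ℓ a, ContDiffAt ℝ ∞ (G.coeff ℓ a) (F.phi x)) (hρ : ∀ j, ρ j ∈ orderIdeal τ 1)
  (hs : s ∈ orderIdeal τ 1 ∨
    fderiv ℝ G.zeroth (F.phi x) = 0 ∧ fderiv ℝ (fderiv ℝ G.zeroth) (F.phi x) = 0)

include hG hρ hs

lemma solutionMap_mem {q : Fin d₂ → MvPowerSeries τ ℝ} (hq : ∀ i, q i ∈ orderIdeal τ 1)
    (α : Fin d₂) : solutionMap F G s ρ x q α ∈ orderIdeal τ 1 := by
  rcases coeff_jointTaylor_partialY_eq_zero hG hs α (μ := 0) (by simp) with h | h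
  · exact Ideal.mul_mem_right _ _ h
  · refine Ideal.mul_mem_left _ _ (mem_orderIdeal_one.2 ?_)
    rw [sumFinsuppEquivProdFinsupp_symm_zero, MvPowerSeries.coeff_zero_eq_constantCoeff_apply] at h
    rw [constantCoeff_subst_of_mem (elim_mem F x hρ hq), h]

/-- The extra order comes from the factor `s`, or else from the vanishing of the terms linear in
`η`; the entries `ρ` do not depend on `q`. -/
lemma solutionMap_sub_mem {k : ℕ} {q q' : Fin d₂ → MvPowerSeries τ ℝ}
    (hq : ∀ i, q i ∈ orderIdeal τ 1) (hq' : ∀ i, q' i ∈ orderIdeal τ 1)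
    (h : ∀ i, q i - q' i ∈ orderIdeal τ k) (α : Fin d₂) :
    solutionMap F G s ρ x q α - solutionMap F G s ρ x q' α ∈ orderIdeal τ (k + 1) := by
  rw [solutionMap, solutionMap, ← mul_sub]
  have hel : ∀ i, Sum.elim (etaOf F x q) ρ i - Sum.elim (etaOf F x q') ρ i ∈ orderIdeal τ k := by
    rintro (i | j)
    · rw [Sum.elim_inl, Sum.elim_inl, etaOf, etaOf, sub_sub_sub_cancel_right]
      exact subst_sub_mem hq hq' h _
    · rw [Sum.elim_inr, Sum.elim_inr, sub_self]
      exact Ideal.zero_mem _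
  by_cases hs1 : s ∈ orderIdeal τ 1
  · rw [add_comm]
    exact mul_mem_orderIdeal hs1
      (subst_sub_mem (elim_mem F x hρ hq) (elim_mem F x hρ hq') hel _)
  · refine Ideal.mul_mem_left _ _
      (subst_sub_mem_succ (elim_mem F x hρ hq) (elim_mem F x hρ hq') hel _ ?_)
    rintro (i | j)
    · left
      rw [← sumFinsuppEquivProdFinsupp_symm_single]
      exact (coeff_jointTaylor_partialY_eq_zero hG hs α (by simp)).resolve_left hs1
    · exact Or.inr (by rw [Sum.elim_inr, Sum.elim_inr])

theorem exists_solution : ∃ ybar qbar, IsSolution F G s ρ x ybar qbar ∧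
    ∀ ybar' qbar', IsSolution F G s ρ x ybar' qbar' → ybar' = ybar ∧ qbar' = qbar := by
  obtain ⟨q, hq, hfix, huniq⟩ := existsUnique_fixedPoint (solutionMap F G s ρ x)
    (fun q hq => solutionMap_mem F hG hρ hs hq)
    (fun k q q' hq hq' h => solutionMap_sub_mem F hG hρ hs hq hq' h)
  refine ⟨fun α => MvPowerSeries.subst q (MvPowerSeries.pderiv ℝ α (F.series x)), q,
    ⟨fun α => mem_orderIdeal_one.1 (hq α), fun α => ?_, fun α => rfl⟩, ?_⟩
  · rw [evalAt_eq F x hq]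
    exact (congrFun hfix α).symm
  · intro ybar' qbar' h
    have hqb : ∀ i, qbar' i ∈ orderIdeal τ 1 := fun i =>
      mem_orderIdeal_one.2 (h.constantCoeff_qbar i)
    have hq' : qbar' = q := huniq qbar' hqb <| funext fun α => by
      rw [h.qbar_eq α, funext h.ybar_eq, evalAt_eq F x hqb]
      rfl
    exact ⟨by rw [← hq']; exact funext h.ybar_eq, hq'⟩

end FixedPoint

/-! ### The composition law as a critical value modulo high order -/

section CriticalValue

variable {d₁ d₂ d₃ : ℕ} {U : Set (Fin d₁ → ℝ)} {V : Set (Fin d₂ → ℝ)} {τ : Type}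
  {G : GeneratingFunction V d₃} {s : MvPowerSeries τ ℝ} {ρ : Fin d₃ → MvPowerSeries τ ℝ}

/-- `F(x, q)` without its linear terms. -/
def reducedSeries (F : GeneratingFunction U d₂) (x : Fin d₁ → ℝ) : MvPowerSeries (Fin d₂) ℝ :=
  F.series x - ∑ i, F.phi x i • MvPowerSeries.X i

lemma seriesCoeff_reducedSeries (F : GeneratingFunction U d₂) (x : Fin d₁ → ℝ)
    (μ : Fin d₂ →₀ ℕ) : seriesCoeff (reducedSeries F x) μ =
      if μ.degree = 1 then 0 else seriesCoeff (F.series x) μ := by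
  classical
  split_ifs with h
  · obtain ⟨i, rfl⟩ := exists_eq_single_of_degree_eq_one h
    rw [seriesCoeff, reducedSeries, map_sub, coeff_series_single, map_sum,
      Finset.sum_eq_single i]
    · simp
    · intro j _ hj
      rw [MvPowerSeries.coeff_smul, MvPowerSeries.coeff_X, if_neg, mul_zero]
      exact fun h => hj (Finsupp.single_left_injective one_ne_zero h).symm
    · simp
  · rw [seriesCoeff, seriesCoeff, reducedSeries, map_sub, map_sum, Finset.sum_eq_zero, sub_zero]
    intro j _
    rw [MvPowerSeries.coeff_smul, MvPowerSeries.coeff_X, if_neg, mul_zero]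
    rintro rfl
    simp at h

lemma subst_reducedSeries (F : GeneratingFunction U d₂) (x : Fin d₁ → ℝ)
    {q : Fin d₂ → MvPowerSeries τ ℝ} (hq : ∀ i, q i ∈ orderIdeal τ 1) :
    MvPowerSeries.subst q (reducedSeries F x) =
      MvPowerSeries.subst q (F.series x) - ∑ i, F.phi x i • q i := by
  have h := hasSubst_of_mem hq
  rw [← MvPowerSeries.coe_substAlgHom (R := ℝ) h, reducedSeries, map_sub, map_sum]
  simp only [map_smul, MvPowerSeries.substAlgHom_X]

lemma subst_pderiv_reducedSeries (F : GeneratingFunction U d₂) (x : Fin d₁ → ℝ)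
    {q : Fin d₂ → MvPowerSeries τ ℝ} (hq : ∀ i, q i ∈ orderIdeal τ 1) (α : Fin d₂) :
    MvPowerSeries.subst q (MvPowerSeries.pderiv ℝ α (reducedSeries F x)) = etaOf F x q α := by
  have h := hasSubst_of_mem hq
  have h1 : MvPowerSeries.pderiv ℝ α (reducedSeries F x) =
      MvPowerSeries.pderiv ℝ α (F.series x) - MvPowerSeries.C (F.phi x α) := by
    rw [reducedSeries, map_sub, map_sum, Finset.sum_eq_single α]
    · simp [MvPowerSeries.smul_eq_C_mul]
    · intro j _ hj
      rw [Derivation.map_smul, MvPowerSeries.pderiv_X_of_ne hj, smul_zero]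
    · simp
  rw [h1, MvPowerSeries.subst_sub h, MvPowerSeries.subst_C, etaOf]

/-- The value of the composition law is, up to terms of high order, the sum over trees with
few vertices and small weights. -/
theorem compositionValue_sub_treeTotal_mem (F : GeneratingFunction U d₂) {x : Fin d₁ → ℝ}
    (hG : ∀ ℓ a, ContDiffAt ℝ ∞ (G.coeff ℓ a) (F.phi x)) (hρ : ∀ j, ρ j ∈ orderIdeal τ 1)
    (hs : s ∈ orderIdeal τ 1 ∨
      fderiv ℝ G.zeroth (F.phi x) = 0 ∧ fderiv ℝ (fderiv ℝ G.zeroth) (F.phi x) = 0)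
    {ybar qbar : Fin d₂ → MvPowerSeries τ ℝ} (h : IsSolution F G s ρ x ybar qbar)
    {N M : ℕ} (hN : 2 ≤ N) (hM : 4 * N + 3 ≤ M) :
    compositionValue F G s ρ x ybar qbar - treeTotal
      (fun μ => algebraMap ℝ (MvPowerSeries τ ℝ) (seriesCoeff (reducedSeries F x) μ))
      (fun μ => ∑ ℓ ∈ Finset.range N, whiteFactor G.coeff s ρ (F.phi x) ℓ μ) M ∈
        orderIdeal τ N := by
  classical
  have hq : ∀ i, qbar i ∈ orderIdeal τ 1 := fun i => mem_orderIdeal_one.2 (h.constantCoeff_qbar i)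
  obtain rfl : ybar = _ := funext h.ybar_eq
  have hη := etaOf_mem F x hq
  set η := etaOf F x qbar with hηdef
  set β : (Fin d₂ →₀ ℕ) → MvPowerSeries τ ℝ := fun μ =>
    algebraMap ℝ (MvPowerSeries τ ℝ) (seriesCoeff (reducedSeries F x) μ) with hβdef
  set γ : (Fin d₂ →₀ ℕ) → MvPowerSeries τ ℝ := fun μ =>
    ∑ ℓ ∈ Finset.range N, whiteFactor G.coeff s ρ (F.phi x) ℓ μ with hγdef
  -- In this quotient the series without constant term generate a nilpotent ideal `J`, and
  -- substitutions become the truncated translations of the tree calculus.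
  let π := Ideal.Quotient.mkₐ ℝ (orderIdeal τ N)
  have hπ : ∀ {f g : MvPowerSeries τ ℝ}, f - g ∈ orderIdeal τ N → π f = π g := fun hfg =>
    Ideal.Quotient.eq.2 hfg
  let J := (orderIdeal τ 1).map π
  have hJmem : ∀ {f : MvPowerSeries τ ℝ}, f ∈ orderIdeal τ 1 → π f ∈ J := fun hf =>
    Ideal.mem_map_of_mem π hf
  have hJ : J ^ N = ⊥ := by
    rw [← Ideal.map_pow, eq_bot_iff, Ideal.map_le_iff_le_comap]
    intro f hf
    rw [Ideal.mem_comap, Ideal.mem_bot]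
    exact Ideal.Quotient.eq_zero_iff_mem.2 (orderIdeal_one_pow_le N hf)
  have hβ1 : ∀ μ, μ.degree = 1 → β μ = 0 := fun μ hμ => by
    simp only [hβdef, seriesCoeff_reducedSeries, if_pos hμ, map_zero]
  have hγ12 : ∀ μ, μ.degree = 1 ∨ μ.degree = 2 → γ μ ∈ orderIdeal τ 1 := fun μ hμ =>
    Ideal.sum_mem _ fun ℓ _ => whiteFactor_mem_one hG hρ hs ℓ hμ
  have t1 := hπ (subst_sub_translate_mem hq (p := reducedSeries F x) (p' := reducedSeries F x)
    (μ₀ := 0) (fun μ => by rw [zero_add]) N)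
  have t2 := fun i => hπ (subst_sub_translate_mem hq (p := reducedSeries F x)
    (seriesCoeff_pderiv (reducedSeries F x) i) N)
  have t3 := hπ (subst_sub_translate_whiteFactor_mem hη hρ s (coeff_jointTaylor hG) N)
  have t4 := fun i => hπ (subst_sub_translate_whiteFactor_mem hη hρ s
    (coeff_jointTaylor_partialY hG i) N)
  have crit := treeTotal_eq_critical_value hN hJ (q := fun i => π (qbar i)) (η := fun i => π (η i))
    (β := fun μ => π (β μ)) (γ := fun μ => π (γ μ)) (fun i => hJmem (hq i)) (fun i => hJmem (hη i))
    (fun μ hμ => by rw [hβ1 μ hμ, map_zero]; exact J.zero_mem)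
    (fun μ hμ => hJmem (hγ12 μ (Or.inl hμ))) (fun μ hμ => hJmem (hγ12 μ (Or.inr hμ)))
    (fun i => by
      rw [← map_translate, ← t2 i, subst_pderiv_reducedSeries F x hq])
    (fun i => by
      rw [← map_translate, ← t4 i]
      have hqi := h.qbar_eq i
      rw [evalAt_eq F x hq] at hqi
      rw [← hqi]) hM
  rw [← map_treeTotal, ← map_translate, ← map_translate, ← t1, ← t3] at crit
  refine Ideal.Quotient.eq.1 (Eq.trans ?_ crit.symm)
  change π _ = _
  rw [compositionValue, evalAt_eq F x hq, subst_reducedSeries F x hq]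
  simp only [← map_mul, ← map_sum, ← map_add, ← map_sub]
  congr 1
  -- From `ȳ = φ + η`: the part `φ q̄` of `ȳ q̄` cancels the linear terms left out of `F`.
  have e : ∑ α, MvPowerSeries.subst qbar (MvPowerSeries.pderiv ℝ α (F.series x)) * qbar α =
      ∑ α, η α * qbar α + ∑ i, F.phi x i • qbar i := by
    rw [← Finset.sum_add_distrib]
    refine Finset.sum_congr rfl fun α _ => ?_
    rw [hηdef, etaOf, MvPowerSeries.smul_eq_C_mul]
    ring
  rw [e]
  ring

end CriticalValue

/-! ### Tree terms in matrix form -/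

section EdgeSum

variable {d b w : ℕ} {S : Type*} [CommRing S]

open Classical in
/-- The sum over all edge indices on the edge set `E` of the products of the vertex factors. -/
def edgeSum (β : (Fin d →₀ ℕ) → S) (y : Fin w → (Fin d →₀ ℕ) → S)
    (E : Finset (Fin b × Fin w)) : S :=
  ∑ L : Fin w → Fin b → Option (Fin d) with edgeSet L = E,
    (∏ v, β (∑ u, idx (L u v))) * ∏ u, y u (∑ v, idx (L u v))

/-- The matrix of a family of edge indices. -/
def indexMatrix {E : Finset (Fin b × Fin w)} (ι : E → Fin d) (u : Fin w) (v : Fin b) :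
    Option (Fin d) :=
  if h : (v, u) ∈ E then some (ι ⟨(v, u), h⟩) else none

lemma edgeSet_indexMatrix {E : Finset (Fin b × Fin w)} (ι : E → Fin d) :
    edgeSet (indexMatrix ι) = E := by
  ext ⟨v, u⟩
  simp [indexMatrix]

lemma sum_coe_eq {E : Finset (Fin b × Fin w)} {M : Type*} [AddCommMonoid M] (g : E → M) :
    ∑ e, g e = ∑ v, ∑ u, if h : (v, u) ∈ E then g ⟨(v, u), h⟩ else 0 := by
  rw [← Fintype.sum_prod_type' (f := fun v u => if h : (v, u) ∈ E then g ⟨(v, u), h⟩ else 0),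
    ← Finset.sum_subset (Finset.subset_univ E), ← Finset.sum_coe_sort E]
  · exact Finset.sum_congr rfl fun e _ => by simp
  · rintro ⟨v, u⟩ _ h
    exact dif_neg h

lemma sum_idx_indexMatrix_black {E : Finset (Fin b × Fin w)} (ι : E → Fin d) (v : Fin b) :
    ∑ u, idx (indexMatrix ι u v) =
      ∑ e with e.1.1 = v, (Finsupp.single (ι e) 1 : Fin d →₀ ℕ) := by
  rw [Finset.sum_filter, sum_coe_eq, Finset.sum_eq_single v]
  · refine Finset.sum_congr rfl fun u _ => ?_
    by_cases h : (v, u) ∈ E <;> simp [indexMatrix, h]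
  · intro v' _ hv'
    exact Finset.sum_eq_zero fun u _ => by simp [hv']
  · simp

lemma sum_idx_indexMatrix_white {E : Finset (Fin b × Fin w)} (ι : E → Fin d) (u : Fin w) :
    ∑ v, idx (indexMatrix ι u v) =
      ∑ e with e.1.2 = u, (Finsupp.single (ι e) 1 : Fin d →₀ ℕ) := by
  rw [Finset.sum_filter, sum_coe_eq]
  refine Finset.sum_congr rfl fun v _ => ?_
  rw [Finset.sum_eq_single u]
  · by_cases h : (v, u) ∈ E <;> simp [indexMatrix, h]
  · intro u' _ hu'
    simp [hu']
  · simp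

lemma edgeSum_eq_sum_index (β : (Fin d →₀ ℕ) → S) (y : Fin w → (Fin d →₀ ℕ) → S)
    (E : Finset (Fin b × Fin w)) :
    edgeSum β y E = ∑ ι : E → Fin d,
      (∏ v, β (∑ e with e.1.1 = v, Finsupp.single (ι e) 1)) *
        ∏ u, y u (∑ e with e.1.2 = u, Finsupp.single (ι e) 1) := by
  classical
  symm
  refine Finset.sum_nbij indexMatrix (fun ι _ => ?_) (fun ι _ ι' _ h => ?_) (fun L hL => ?_)
    (fun ι _ => ?_)
  · simp [edgeSet_indexMatrix]
  · funext ⟨⟨v, u⟩, he⟩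
    have := congrFun (congrFun h u) v
    simpa [indexMatrix, he] using this
  · have hE : edgeSet L = E := by simpa using hL
    subst hE
    have hne : ∀ e : edgeSet L, ∃ i, L e.1.2 e.1.1 = some i := fun e =>
      Option.ne_none_iff_exists'.1 (mem_edgeSet.1 e.2)
    choose ι hι using hne
    refine ⟨ι, by simp, ?_⟩
    funext u v
    by_cases h : L u v = none
    · simp [indexMatrix, h]
    · have := hι ⟨(v, u), mem_edgeSet.2 h⟩
      simp only at this
      simp [indexMatrix, this]
  · simp only [sum_idx_indexMatrix_black, sum_idx_indexMatrix_white]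

lemma degree_black_eq (L : Fin w → Fin b → Option (Fin d)) (v : Fin b) :
    (∑ u, idx (L u v)).degree = ((edgeSet L).filter fun e => e.1 = v).card := by
  have h : (edgeSet L).filter (fun e => e.1 = v) =
      (Finset.univ.filter fun u => L u v ≠ none).map ⟨fun u => (v, u), Prod.mk_right_injective v⟩ := by
    ext ⟨v', u⟩
    simp only [Finset.mem_filter, mem_edgeSet, Finset.mem_map, Finset.mem_univ, true_and,
      Function.Embedding.coeFn_mk, Prod.mk.injEq]
    constructor
    · rintro ⟨h, rfl⟩
      exact ⟨u, h, rfl, rfl⟩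
    · rintro ⟨u', h, rfl, rfl⟩
      exact ⟨h, rfl⟩
  rw [h, Finset.card_map, Finset.card_filter, map_sum]
  refine Finset.sum_congr rfl fun u _ => ?_
  by_cases h : L u v = none <;> simp [degree_idx, h]

/-- With `edgeSum_eq_zero`, this says that passing from `F` to its reduced series leaves
white-leaved trees unchanged and removes all others. -/
lemma edgeSum_congr {β β' : (Fin d →₀ ℕ) → S} (h : ∀ μ, μ.degree ≠ 1 → β μ = β' μ)
    (y : Fin w → (Fin d →₀ ℕ) → S) {E : Finset (Fin b × Fin w)}
    (hE : ∀ v, (E.filter fun e => e.1 = v).card ≠ 1) : edgeSum β y E = edgeSum β' y E := by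
  classical
  refine Finset.sum_congr rfl fun L hL => ?_
  obtain rfl := (Finset.mem_filter.1 hL).2
  congr 1
  exact Finset.prod_congr rfl fun v _ => h _ (by rw [degree_black_eq]; exact hE v)

lemma edgeSum_eq_zero {β : (Fin d →₀ ℕ) → S} (h : ∀ μ, μ.degree = 1 → β μ = 0)
    (y : Fin w → (Fin d →₀ ℕ) → S) {E : Finset (Fin b × Fin w)}
    (hE : ¬ ∀ v, (E.filter fun e => e.1 = v).card ≠ 1) : edgeSum β y E = 0 := by
  classical
  push Not at hE
  obtain ⟨v, hv⟩ := hE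
  refine Finset.sum_eq_zero fun L hL => ?_
  obtain rfl := (Finset.mem_filter.1 hL).2
  rw [Finset.prod_eq_zero (Finset.mem_univ v) (h _ (by rw [degree_black_eq]; exact hv)), zero_mul]

-- Grouping matrices by edge set and multiplying out the sums over `ℓ` at the white vertices yields
-- one summand for each assignment of weights.
open Classical in
lemma treeSum_eq_sum_edgeSum (β : (Fin d →₀ ℕ) → S) (y : ℕ → (Fin d →₀ ℕ) → S) (N b w : ℕ) :
    treeSum β (fun μ => ∑ ℓ ∈ Finset.range N, y ℓ μ) b w =
      ∑ E : Finset (Fin b × Fin w) with (bipartiteGraph E).IsTree,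
        ∑ k : Fin w → Fin N, edgeSum β (fun u => y (k u)) E := by
  have hmaps : ∀ L ∈ Finset.univ.filter
      (fun L : Fin w → Fin b → Option (Fin d) => IsTreeMatrix L), edgeSet L ∈
        Finset.univ.filter fun E : Finset (Fin b × Fin w) => (bipartiteGraph E).IsTree :=
    fun L hL => Finset.mem_filter.2 ⟨Finset.mem_univ _, (Finset.mem_filter.1 hL).2⟩
  rw [treeSum, ← Finset.sum_fiberwise_of_maps_to hmaps]
  refine Finset.sum_congr rfl fun E hE => ?_
  have hf : (Finset.univ.filter fun L : Fin w → Fin b → Option (Fin d) => IsTreeMatrix L).filter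
      (fun L => edgeSet L = E) = Finset.univ.filter fun L => edgeSet L = E := by
    ext L
    simp only [Finset.mem_filter, Finset.mem_univ, true_and, and_iff_right_iff_imp]
    rintro rfl
    exact (Finset.mem_filter.1 hE).2
  simp only [edgeSum]
  rw [hf, Finset.sum_comm]
  refine Finset.sum_congr rfl fun L _ => ?_
  rw [← Finset.mul_sum]
  congr 1
  simp only [Finset.sum_range]
  rw [Finset.prod_univ_sum, Fintype.piFinset_univ]

lemma edgeSum_mem {J : Ideal S} {N : ℕ} {β : (Fin d →₀ ℕ) → S} {y : Fin w → (Fin d →₀ ℕ) → S}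
    {E : Finset (Fin b × Fin w)} (hE : (bipartiteGraph E).IsTree)
    (hβ : ∀ v, (E.filter fun e => e.1 = v).card ≠ 1)
    (hy : ∀ u μ, μ.degree = 1 ∨ μ.degree = 2 → y u μ ∈ J) (h : 4 * N + 2 ≤ b + w) :
    edgeSum β y E ∈ J ^ N := by
  classical
  refine Ideal.sum_mem _ fun L hL => ?_
  obtain rfl := (Finset.mem_filter.1 hL).2
  refine IsTreeMatrix.prod_mem (L := L) hE (fun v hv => ?_) (fun u hu => hy u _ (Or.inl hu))
    (Or.inl fun u hu => hy u _ (Or.inr hu)) h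
  -- There are no black leaves, so nothing is required of `β`.
  exact absurd (by rwa [degree_black_eq] at hv) (hβ v)

lemma edgeSum_mem_of_white {I : Ideal S} {β : (Fin d →₀ ℕ) → S} {y : Fin w → (Fin d →₀ ℕ) → S}
    {E : Finset (Fin b × Fin w)} {u : Fin w} (hu : ∀ μ, y u μ ∈ I) : edgeSum β y E ∈ I := by
  classical
  refine Ideal.sum_mem _ fun L _ => Ideal.mul_mem_left _ _ ?_
  rw [← Finset.mul_prod_erase _ _ (Finset.mem_univ u)]
  exact Ideal.mul_mem_right _ _ (hu _)

lemma edgeSum_equiv {b' w' : ℕ} (f : Fin b ≃ Fin b') (g : Fin w ≃ Fin w')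
    {E : Finset (Fin b × Fin w)} {E' : Finset (Fin b' × Fin w')}
    (hE : ∀ v u, (f v, g u) ∈ E' ↔ (v, u) ∈ E) (β : (Fin d →₀ ℕ) → S)
    {y : Fin w → (Fin d →₀ ℕ) → S} {y' : Fin w' → (Fin d →₀ ℕ) → S} (hy : ∀ u, y' (g u) = y u) :
    edgeSum β y E = edgeSum β y' E' := by
  classical
  refine Finset.sum_equiv (g.arrowCongr (f.arrowCongr (Equiv.refl _))) (fun L => ?_) fun L _ => ?_
  · simp only [Finset.mem_filter, Finset.mem_univ, true_and, Finset.ext_iff, Prod.forall,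
      mem_edgeSet]
    rw [← f.forall_congr_right]
    refine forall_congr' fun v => ?_
    rw [← g.forall_congr_right]
    refine forall_congr' fun u => ?_
    simp [hE]
  · rw [← f.prod_comp, ← g.prod_comp]
    congr 1
    · refine Finset.prod_congr rfl fun v _ => ?_
      rw [← g.sum_comp]
      simp
    · refine Finset.prod_congr rfl fun u _ => ?_
      rw [← f.sum_comp, hy]
      simp

end EdgeSum

namespace WTree

section Term

variable {d₁ d₂ d₃ : ℕ} {U : Set (Fin d₁ → ℝ)} {V : Set (Fin d₂ → ℝ)} {τ : Type}

lemma content_enum {t : WTree} (s : Finset t.edges) (ι : t.edges → Fin d₂) :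
    content (fun k => ι (enum s k)) = ∑ e ∈ s, Finsupp.single (ι e) 1 := by
  rw [content, ← Finset.sum_coe_sort s]
  exact s.equivFin.symm.sum_comp fun e => Finsupp.single (ι e.1) 1

/-- By symmetry of the coefficients of `F` and of partial derivatives, only the multi-index at each
vertex matters and not the chosen enumeration of its edges. -/
lemma contraction_eq (F : GeneratingFunction U d₂) {G : GeneratingFunction V d₃} {x : Fin d₁ → ℝ}
    (hG : ∀ ℓ a, ContDiffAt ℝ ∞ (G.coeff ℓ a) (F.phi x)) (t : WTree)
    (a : ∀ w : Fin t.numWhite, Fin (t.weight w) → Fin d₃) :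
    t.contraction F G x a = ∑ ι : t.edges → Fin d₂,
      (∏ v, seriesCoeff (F.series x) (∑ e with e.1.1 = v, Finsupp.single (ι e) 1)) *
      ∏ w, taylorCoeff (G.coeff (t.weight w) (a w)) (F.phi x)
        (∑ e with e.1.2 = w, Finsupp.single (ι e) 1) := by
  refine Finset.sum_congr rfl fun ι _ => ?_
  congr 1
  · refine Finset.prod_congr rfl fun v _ => ?_
    change _ = seriesCoeff (F.series x) (∑ e ∈ t.blackEdges v, Finsupp.single (ι e) 1)
    rw [← content_enum, seriesCoeff, GeneratingFunction.series, coeff_tensorSeries]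
    intro k t t' h
    obtain ⟨σ, rfl⟩ := exists_perm_of_content_eq h
    rw [F.symm]
  · refine Finset.prod_congr rfl fun w _ => ?_
    change _ = taylorCoeff _ _ (∑ e ∈ t.whiteEdges w, Finsupp.single (ι e) 1)
    rw [← content_enum, taylorCoeff_content (hG _ _)]

lemma term_eq (F : GeneratingFunction U d₂) {G : GeneratingFunction V d₃} {x : Fin d₁ → ℝ}
    (hG : ∀ ℓ a, ContDiffAt ℝ ∞ (G.coeff ℓ a) (F.phi x)) (s : MvPowerSeries τ ℝ)
    (ρ : Fin d₃ → MvPowerSeries τ ℝ) (t : WTree) :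
    t.term F G s ρ x =
      edgeSum (fun μ => algebraMap ℝ (MvPowerSeries τ ℝ) (seriesCoeff (F.series x) μ))
        (fun u => whiteFactor G.coeff s ρ (F.phi x) (t.weight u)) t.edges := by
  rw [edgeSum_eq_sum_index, term]
  simp only [contraction_eq F hG, Finset.sum_smul, whiteFactor]
  rw [Finset.sum_comm, Finset.mul_sum]
  refine Finset.sum_congr rfl fun ι _ => ?_
  rw [Finset.prod_mul_distrib, Finset.prod_const, Finset.card_univ, Fintype.card_fin,
    Finset.prod_univ_sum, Fintype.piFinset_univ, mul_left_comm]
  congr 1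
  rw [Finset.mul_sum]
  refine Finset.sum_congr rfl fun a _ => ?_
  rw [Algebra.smul_def, map_mul, map_prod, map_prod, mul_assoc, ← Finset.prod_mul_distrib]
  congr 1
  refine Finset.prod_congr rfl fun w _ => ?_
  rw [Algebra.smul_def]

lemma term_eq_of_iso (F : GeneratingFunction U d₂) {G : GeneratingFunction V d₃} {x : Fin d₁ → ℝ}
    (hG : ∀ ℓ a, ContDiffAt ℝ ∞ (G.coeff ℓ a) (F.phi x)) (s : MvPowerSeries τ ℝ)
    (ρ : Fin d₃ → MvPowerSeries τ ℝ) {t t' : WTree} (f : Iso t t') :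
    t.term F G s ρ x = t'.term F G s ρ x := by
  rw [term_eq F hG, term_eq F hG]
  exact edgeSum_equiv f.black f.white f.map_edges _ fun u => by rw [f.map_weight]

lemma term_mem {F : GeneratingFunction U d₂} {G : GeneratingFunction V d₃} {x : Fin d₁ → ℝ}
    (hG : ∀ ℓ a, ContDiffAt ℝ ∞ (G.coeff ℓ a) (F.phi x)) {s : MvPowerSeries τ ℝ}
    {ρ : Fin d₃ → MvPowerSeries τ ℝ} (hρ : ∀ j, ρ j ∈ orderIdeal τ 1)
    (hs : s ∈ orderIdeal τ 1 ∨
      fderiv ℝ G.zeroth (F.phi x) = 0 ∧ fderiv ℝ (fderiv ℝ G.zeroth) (F.phi x) = 0)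
    {N : ℕ} {t : WTree} (h : 4 * N + 2 ≤ t.numBlack + t.numWhite ∨ ∃ u, N ≤ t.weight u) :
    t.term F G s ρ x ∈ orderIdeal τ N := by
  rw [term_eq F hG]
  rcases h with h | ⟨u, hu⟩
  · exact orderIdeal_one_pow_le N (edgeSum_mem t.isTree t.whiteLeaved
      (fun u μ hμ => whiteFactor_mem_one hG hρ hs _ hμ) h)
  · exact edgeSum_mem_of_white fun μ => orderIdeal_anti hu (whiteFactor_mem hρ _ _ μ)

end Term

/-! ### Sums over labelled trees -/

section LabelledSum

/-- The data of a tree with less than `M` vertices of each colour and weights less than `N`. -/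
abbrev SmallTree (M N : ℕ) : Type :=
  Σ b : Fin M, Σ w : Fin M, {E : Finset (Fin b × Fin w) // (bipartiteGraph E).IsTree ∧
    ∀ v, (E.filter fun e => e.1 = v).card ≠ 1} × (Fin w → Fin N)

/-- The tree with the given data. -/
def SmallTree.toTree {M N : ℕ} (i : SmallTree M N) : WTree :=
  ⟨i.1, i.2.1, i.2.2.1.1, i.2.2.1.2.1, i.2.2.1.2.2, fun u => i.2.2.2 u⟩

lemma SmallTree.toTree_injective {M N : ℕ} :
    Function.Injective (SmallTree.toTree : SmallTree M N → WTree) := by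
  rintro ⟨⟨b, hb⟩, ⟨w, hw⟩, ⟨E, hE⟩, k⟩ ⟨⟨b', hb'⟩, ⟨w', hw'⟩, ⟨E', hE'⟩, k'⟩ h
  simp only [SmallTree.toTree, WTree.mk.injEq] at h
  obtain ⟨rfl, rfl, h1, h2⟩ := h
  obtain rfl := eq_of_heq h1
  have : k = k' := by
    funext u
    exact Fin.ext (congrFun (eq_of_heq h2) u)
  rw [this]

lemma SmallTree.mem_range_toTree {M N : ℕ} {t : WTree} (hb : t.numBlack < M)
    (hw : t.numWhite < M) (hk : ∀ u, t.weight u < N) :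
    t ∈ Set.range (SmallTree.toTree : SmallTree M N → WTree) :=
  ⟨⟨⟨_, hb⟩, ⟨_, hw⟩, ⟨t.edges, t.isTree, t.whiteLeaved⟩, fun u => ⟨t.weight u, hk u⟩⟩, rfl⟩

open Classical in
lemma finsum_eq_of_small {M N : ℕ} {f : WTree → ℝ}
    (hf : ∀ t, M ≤ t.numBlack ∨ M ≤ t.numWhite ∨ (∃ u, N ≤ t.weight u) → f t = 0)
    (g : ∀ b w, Finset (Fin b × Fin w) → (Fin w → Fin N) → ℝ)
    (hg : ∀ i : SmallTree M N, f i.toTree = g i.1 i.2.1 i.2.2.1.1 i.2.2.2) :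
    (Function.support f).Finite ∧ ∑ᶠ t, f t = ∑ b ∈ Finset.range M, ∑ w ∈ Finset.range M,
      ∑ E : Finset (Fin b × Fin w) with (bipartiteGraph E).IsTree ∧
        ∀ v, (E.filter fun e => e.1 = v).card ≠ 1, ∑ k, g b w E k := by
  have hsub : Function.support f ⊆
      (Finset.univ.map ⟨_, SmallTree.toTree_injective (M := M) (N := N)⟩ : Finset WTree) := by
    intro t ht
    have h := mt (hf t) ht
    push Not at h
    obtain ⟨i, hi⟩ := SmallTree.mem_range_toTree h.1 h.2.1 h.2.2
    simp only [Finset.coe_map, Finset.coe_univ, Set.image_univ]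
    exact ⟨i, hi⟩
  refine ⟨(Finset.finite_toSet _).subset hsub, ?_⟩
  rw [finsum_eq_sum_of_support_subset _ hsub, Finset.sum_map, Fintype.sum_sigma, Finset.sum_range]
  refine Finset.sum_congr rfl fun b _ => ?_
  rw [Fintype.sum_sigma, Finset.sum_range]
  refine Finset.sum_congr rfl fun w _ => ?_
  rw [Fintype.sum_prod_type, Finset.sum_subtype (Finset.univ.filter _) (fun E => by
    rw [Finset.mem_filter, and_iff_right (Finset.mem_univ E)])]
  refine Finset.sum_congr rfl fun E _ => Finset.sum_congr rfl fun k _ => ?_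
  exact hg ⟨b, w, E, k⟩

variable {d₁ d₂ d₃ : ℕ} {U : Set (Fin d₁ → ℝ)} {V : Set (Fin d₂ → ℝ)} {τ : Type}

theorem isFormalSum_labelled {F : GeneratingFunction U d₂} {G : GeneratingFunction V d₃}
    {x : Fin d₁ → ℝ} (hG : ∀ ℓ a, ContDiffAt ℝ ∞ (G.coeff ℓ a) (F.phi x))
    {s : MvPowerSeries τ ℝ} {ρ : Fin d₃ → MvPowerSeries τ ℝ} (hρ : ∀ j, ρ j ∈ orderIdeal τ 1)
    (hs : s ∈ orderIdeal τ 1 ∨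
      fderiv ℝ G.zeroth (F.phi x) = 0 ∧ fderiv ℝ (fderiv ℝ G.zeroth) (F.phi x) = 0)
    {ybar qbar : Fin d₂ → MvPowerSeries τ ℝ} (h : IsSolution F G s ρ x ybar qbar) :
    IsFormalSum (fun t : WTree => ((t.numWhite.factorial : ℝ) * (t.numBlack.factorial : ℝ))⁻¹ •
      t.term F G s ρ x) (compositionValue F G s ρ x ybar qbar) := by
  classical
  intro n
  -- Order above `n.degree` would suffice for the coefficient; the second unit secures the bound `2
  -- ≤ N` required by the critical value formula.
  let N := n.degree + 2
  let M := 4 * N + 3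
  have hn : n.degree < N := by omega
  let y : ℕ → (Fin d₂ →₀ ℕ) → MvPowerSeries τ ℝ := fun ℓ => whiteFactor G.coeff s ρ (F.phi x) ℓ
  let β : (Fin d₂ →₀ ℕ) → MvPowerSeries τ ℝ := fun μ => algebraMap ℝ _ (seriesCoeff (F.series x) μ)
  let β' : (Fin d₂ →₀ ℕ) → MvPowerSeries τ ℝ := fun μ =>
    algebraMap ℝ _ (seriesCoeff (reducedSeries F x) μ)
  have hβ : ∀ μ, μ.degree ≠ 1 → β' μ = β μ := fun μ hμ => by
    simp only [β, β', seriesCoeff_reducedSeries, if_neg hμ]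
  have hβ' : ∀ μ, μ.degree = 1 → β' μ = 0 := fun μ hμ => by
    simp only [β', seriesCoeff_reducedSeries, if_pos hμ, map_zero]
  obtain ⟨h1, h2⟩ := finsum_eq_of_small (M := M) (N := N)
    (f := fun t => MvPowerSeries.coeff n
      (((t.numWhite.factorial : ℝ) * (t.numBlack.factorial : ℝ))⁻¹ • t.term F G s ρ x))
    (fun t ht => by
      have : t.term F G s ρ x ∈ orderIdeal τ N := term_mem hG hρ hs (by
        rcases ht with ht | ht | ht
        · left; omega
        · left; omega
        · exact Or.inr ht)
      rw [MvPowerSeries.coeff_smul, this n hn, mul_zero])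
    (fun b w E k => MvPowerSeries.coeff n (((w.factorial : ℝ) * (b.factorial : ℝ))⁻¹ •
      edgeSum β (fun u => y (k u)) E))
    (fun i => by rw [term_eq F hG]; rfl)
  refine ⟨h1, ?_⟩
  rw [h2, coeff_eq_of_sub_mem (compositionValue_sub_treeTotal_mem F hG hρ hs h
    (N := N) (M := M) (by omega) le_rfl) hn, treeTotal, map_sum]
  refine Finset.sum_congr rfl fun b _ => ?_
  rw [map_sum]
  refine Finset.sum_congr rfl fun w _ => ?_
  rw [treeSum_eq_sum_edgeSum β' y, Finset.smul_sum, map_sum, ← Finset.filter_filter]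
  symm
  rw [Finset.sum_filter]
  refine Finset.sum_congr rfl fun E _ => ?_
  rw [Finset.smul_sum, map_sum, mul_comm]
  split_ifs with hE
  · exact Finset.sum_congr rfl fun k _ => by rw [edgeSum_congr hβ _ hE]
  · symm
    exact Finset.sum_eq_zero fun k _ => by rw [edgeSum_eq_zero hβ' _ hE, smul_zero, map_zero]

end LabelledSum

/-! ### Sums over isomorphism classes -/

section IsoClasses

namespace Iso

lemma numBlack_eq {t t' : WTree} (f : Iso t t') : t.numBlack = t'.numBlack := by
  simpa using Fintype.card_congr f.black

lemma numWhite_eq {t t' : WTree} (f : Iso t t') : t.numWhite = t'.numWhite := by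
  simpa using Fintype.card_congr f.white

/-- The composition of isomorphisms. -/
def trans {t t' t'' : WTree} (f : Iso t t') (g : Iso t' t'') : Iso t t'' :=
  ⟨f.black.trans g.black, f.white.trans g.white,
    fun v w => (g.map_edges _ _).trans (f.map_edges v w),
    fun w => (g.map_weight _).trans (f.map_weight w)⟩

/-- The inverse of an isomorphism. -/
def symm {t t' : WTree} (f : Iso t t') : Iso t' t :=
  ⟨f.black.symm, f.white.symm,
    fun v w => by simpa using (f.map_edges (f.black.symm v) (f.white.symm w)).symm,
    fun w => by simpa using (f.map_weight (f.white.symm w)).symm⟩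

@[ext] lemma ext {t t' : WTree} {f g : Iso t t'} (h1 : f.black = g.black)
    (h2 : f.white = g.white) : f = g := by
  cases f; cases g; simp_all

/-- Composition with an isomorphism is a bijection of sets of isomorphisms. -/
def congrRight {t t' : WTree} (f : Iso t t') : Iso t t ≃ Iso t t' where
  toFun g := g.trans f
  invFun g := g.trans f.symm
  left_inv g := by ext <;> simp [trans, symm]
  right_inv g := by ext <;> simp [trans, symm]

end Iso

/-- The tree `t` with relabelled vertices. -/
def relabel (t : WTree) (σ : Equiv.Perm (Fin t.numBlack)) (π : Equiv.Perm (Fin t.numWhite)) :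
    WTree where
  numBlack := t.numBlack
  numWhite := t.numWhite
  edges := t.edges.map (σ.prodCongr π).toEmbedding
  isTree := by
    let e : bipartiteGraph t.edges ≃g
        bipartiteGraph (t.edges.map (σ.prodCongr π).toEmbedding) :=
      { toEquiv := σ.sumCongr π
        map_rel_iff' := by
          rintro (a | a) (c | c) <;> simp }
    exact e.isTree_iff.1 t.isTree
  whiteLeaved := fun v => by
    have h := t.whiteLeaved (σ.symm v)
    rw [Finset.filter_map, Finset.card_map]
    convert h using 3
    simp [Equiv.eq_symm_apply]
  weight := fun u => t.weight (π.symm u)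

/-- The isomorphism from a tree to its relabelling. -/
def relabelIso (t : WTree) (σ : Equiv.Perm (Fin t.numBlack)) (π : Equiv.Perm (Fin t.numWhite)) :
    Iso t (t.relabel σ π) where
  black := σ
  white := π
  map_edges v w := by
    change (σ v, π w) ∈ t.edges.map (σ.prodCongr π).toEmbedding ↔ _
    simp [Finset.mem_map_equiv]
  map_weight w := congrArg t.weight (π.symm_apply_apply w)

/-- An isomorphic tree has the same sets of labels, so an isomorphism out of `t` amounts to a pair
of permutations, which determine its target. -/
lemma relabel_bijective (t : WTree) : Function.Bijective
    (fun p : Equiv.Perm (Fin t.numBlack) × Equiv.Perm (Fin t.numWhite) =>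
      (⟨t.relabel p.1 p.2, t.relabelIso p.1 p.2⟩ : Σ t', Iso t t')) := by
  constructor
  · let Ψ : (Σ t', Iso t t') → (Fin t.numBlack → ℕ) × (Fin t.numWhite → ℕ) := fun p =>
      (fun v => (p.2.black v : ℕ), fun u => (p.2.white u : ℕ))
    rintro ⟨σ, π⟩ ⟨σ', π'⟩ h
    have h' := congrArg Ψ h
    simp only [Ψ, relabelIso, Prod.mk.injEq] at h'
    refine Prod.ext (Equiv.ext fun v => Fin.ext ?_) (Equiv.ext fun u => Fin.ext ?_)
    · exact congrFun h'.1 v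
    · exact congrFun h'.2 u
  · rintro ⟨t', f⟩
    have hb := f.numBlack_eq
    have hw := f.numWhite_eq
    obtain ⟨b, w, E, hE, hl, k⟩ := t
    obtain ⟨b', w', E', hE', hl', k'⟩ := t'
    simp only at hb hw
    subst hb hw
    obtain ⟨σ, π, he, hk⟩ := f
    change Equiv.Perm (Fin b) at σ
    change Equiv.Perm (Fin w) at π
    refine ⟨⟨σ, π⟩, ?_⟩
    have e1 : E.map (σ.prodCongr π).toEmbedding = E' := by
      ext ⟨v, u⟩
      have := he (σ.symm v) (π.symm u)
      simp only [Equiv.apply_symm_apply] at this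
      rw [this, Finset.mem_map_equiv]
      rfl
    have e2 : (fun u => k (π.symm u)) = k' := by
      funext u
      have := hk (π.symm u)
      simp only [Equiv.apply_symm_apply] at this
      exact this.symm
    subst e1 e2
    rfl

/-- Orbit counting: the `b! w!` relabellings correspond to pairs of a tree in the class and an
isomorphism to it, and for each tree these isomorphisms are in bijection with the automorphisms of
`t`. -/
lemma card_class_mul_symCard (t : WTree) :
    {t' | Nonempty (Iso t t')}.Finite ∧ {t' | Nonempty (Iso t t')}.ncard * t.symCard =
      t.numBlack.factorial * t.numWhite.factorial := by
  have e := Equiv.ofBijective _ t.relabel_bijective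
  have hfin : Finite (Σ t', Iso t t') := Finite.of_equiv _ e
  have hcls : {t' | Nonempty (Iso t t')}.Finite := by
    have : {t' | Nonempty (Iso t t')} = Set.range (Sigma.fst : (Σ t', Iso t t') → WTree) := by
      ext t'
      exact ⟨fun ⟨f⟩ => ⟨⟨t', f⟩, rfl⟩, fun ⟨p, hp⟩ => hp ▸ ⟨p.2⟩⟩
    rw [this]
    exact Set.finite_range _
  refine ⟨hcls, ?_⟩
  have e2 : (Σ t', Iso t t') ≃ {t' | Nonempty (Iso t t')} × Iso t t :=
    { toFun := fun p => (⟨p.1, ⟨p.2⟩⟩, p.2.trans (Classical.choice (⟨p.2⟩ : Nonempty _)).symm)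
      invFun := fun p => ⟨p.1.1, p.2.trans (Classical.choice p.1.2)⟩
      left_inv := fun p => by
        refine Sigma.ext rfl (heq_of_eq ?_)
        exact (Iso.congrRight _).right_inv p.2
      right_inv := fun p => by
        refine Prod.ext rfl ?_
        exact (Iso.congrRight _).left_inv p.2 }
  have h1 := Nat.card_congr (e.trans e2)
  rw [Nat.card_prod, Nat.card_prod, Nat.card_perm, Nat.card_perm, Nat.card_fin, Nat.card_fin,
    Nat.card_coe_set_eq] at h1
  exact h1.symm

/-- A sum over labelled trees of terms that are invariant under isomorphisms, in terms of
isomorphism classes. -/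
lemma finsum_isoClass {φ : WTree → ℝ} (hφ : ∀ t t', Nonempty (Iso t t') → φ t = φ t')
    (hfin : (Function.support fun t : WTree =>
      ((t.numWhite.factorial : ℝ) * (t.numBlack.factorial : ℝ))⁻¹ * φ t).Finite)
    (rep : IsoClass → WTree) (hrep : ∀ c, Quotient.mk isoSetoid (rep c) = c) :
    (Function.support fun c => ((rep c).symCard : ℝ)⁻¹ * φ (rep c)).Finite ∧
      ∑ᶠ t : WTree, ((t.numWhite.factorial : ℝ) * (t.numBlack.factorial : ℝ))⁻¹ * φ t =
        ∑ᶠ c, ((rep c).symCard : ℝ)⁻¹ * φ (rep c) := by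
  classical
  set h : WTree → ℝ := fun t =>
    ((t.numWhite.factorial : ℝ) * (t.numBlack.factorial : ℝ))⁻¹ * φ t with hdef
  set g : IsoClass → ℝ := fun c => ((rep c).symCard : ℝ)⁻¹ * φ (rep c) with gdef
  have hfac : ∀ t : WTree, ((t.numWhite.factorial : ℝ) * (t.numBlack.factorial : ℝ))⁻¹ ≠ 0 :=
    fun t => inv_ne_zero (mul_ne_zero (Nat.cast_ne_zero.2 (Nat.factorial_ne_zero _))
      (Nat.cast_ne_zero.2 (Nat.factorial_ne_zero _)))
  let C : Finset IsoClass := hfin.toFinset.image (Quotient.mk isoSetoid)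
  have hsupp : Function.support g ⊆ C := by
    intro c hc
    have hc' : φ (rep c) ≠ 0 := fun h0 => hc (by simp only [gdef, h0, mul_zero])
    refine Finset.mem_coe.2 (Finset.mem_image.2 ⟨rep c, ?_, hrep c⟩)
    rw [Set.Finite.mem_toFinset]
    exact mul_ne_zero (hfac _) hc'
  refine ⟨C.finite_toSet.subset hsupp, ?_⟩
  rw [finsum_eq_sum_of_support_subset g hsupp, finsum_eq_sum_of_support_toFinset_subset h hfin
    subset_rfl, ← Finset.sum_fiberwise_of_maps_to (t := C) (g := Quotient.mk isoSetoid)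
    (fun t ht => Finset.mem_image_of_mem _ ht)]
  refine Finset.sum_congr rfl fun c _ => ?_
  have hclass : ∀ t, Quotient.mk isoSetoid t = c ↔ Nonempty (Iso (rep c) t) := fun t => by
    conv_lhs => rw [← hrep c, eq_comm]
    exact Quotient.eq
  by_cases h0 : φ (rep c) = 0
  · rw [Finset.sum_eq_zero]
    · simp only [gdef, h0, mul_zero]
    · intro t ht
      have := (hclass t).1 (Finset.mem_filter.1 ht).2
      simp only [hdef, ← hφ _ _ this, h0, mul_zero]
  · obtain ⟨hcfin, hcard⟩ := (rep c).card_class_mul_symCard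
    have hset : hfin.toFinset.filter (fun t => Quotient.mk isoSetoid t = c) =
        hcfin.toFinset := by
      ext t
      rw [Finset.mem_filter, Set.Finite.mem_toFinset, Set.Finite.mem_toFinset, hclass]
      refine ⟨fun ht => ht.2, fun ht => ⟨?_, ht⟩⟩
      refine mul_ne_zero (hfac t) ?_
      rwa [← hφ _ _ ht]
    have hterm : ∀ t ∈ hcfin.toFinset, h t = h (rep c) := by
      intro t ht
      obtain ⟨f⟩ := hcfin.mem_toFinset.1 ht
      simp only [hdef, ← f.numBlack_eq, ← f.numWhite_eq, ← hφ _ _ ⟨f⟩]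
    rw [hset, Finset.sum_congr rfl hterm, Finset.sum_const, nsmul_eq_mul,
      ← Set.ncard_eq_toFinset_card _ hcfin]
    simp only [hdef, gdef]
    -- The class has `b! w! / |sym|` members with equal terms, so the weight `1 / (b! w!)` becomes
    -- `1 / |sym|`.
    have hcard' := congrArg (Nat.cast (R := ℝ)) hcard
    push_cast at hcard'
    have hb : ((rep c).numBlack.factorial : ℝ) ≠ 0 := Nat.cast_ne_zero.2 (Nat.factorial_ne_zero _)
    have hw : ((rep c).numWhite.factorial : ℝ) ≠ 0 := Nat.cast_ne_zero.2 (Nat.factorial_ne_zero _)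
    have hsym : ((rep c).symCard : ℝ) ≠ 0 := fun h0 => by
      rw [h0, mul_zero] at hcard'
      exact mul_ne_zero hb hw hcard'.symm
    have hm : ({t' | Nonempty (Iso (rep c) t')}.ncard : ℝ) ≠ 0 := fun h0 => by
      rw [h0, zero_mul] at hcard'
      exact mul_ne_zero hb hw hcard'.symm
    rw [← mul_assoc]
    congr 1
    rw [mul_comm ((rep c).numWhite.factorial : ℝ), ← hcard']
    field_simp

end IsoClasses

end WTree

/-- Common form of the two senses: `s` is the formal variable `ε`, which has positive order, or `s =
1` with vanishing first and second derivatives of `G₀`. -/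
theorem hasTreeExpansion {d₁ d₂ d₃ : ℕ} {U : Set (Fin d₁ → ℝ)} {V : Set (Fin d₂ → ℝ)} {τ : Type}
    {F : GeneratingFunction U d₂} {G : GeneratingFunction V d₃} {x : Fin d₁ → ℝ}
    (hG : ∀ ℓ a, ContDiffAt ℝ ∞ (G.coeff ℓ a) (F.phi x))
    {s : MvPowerSeries τ ℝ} {ρ : Fin d₃ → MvPowerSeries τ ℝ} (hρ : ∀ j, ρ j ∈ orderIdeal τ 1)
    (hs : s ∈ orderIdeal τ 1 ∨
      fderiv ℝ G.zeroth (F.phi x) = 0 ∧ fderiv ℝ (fderiv ℝ G.zeroth) (F.phi x) = 0) :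
    HasTreeExpansion F G s ρ x := by
  obtain ⟨ybar, qbar, hsol, huniq⟩ := exists_solution F hG hρ hs
  have hlab := WTree.isFormalSum_labelled hG hρ hs hsol
  refine ⟨ybar, qbar, hsol, huniq, hlab, fun rep hrep n => ?_⟩
  obtain ⟨h1, h2⟩ := hlab n
  simp only [MvPowerSeries.coeff_smul] at h1 h2 ⊢
  obtain ⟨h3, h4⟩ := WTree.finsum_isoClass
    (φ := fun t => MvPowerSeries.coeff n (t.term F G s ρ x))
    (fun t t' ⟨f⟩ => by rw [WTree.term_eq_of_iso F hG s ρ f]) h1 rep hrep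
  exact ⟨h3, h2.trans h4⟩

end ThickMorphism

end

/-- Tree expansion of the generating function of the composite `Φ_G ∘ Φ_F`.
First part: expansion as a functional power series in `G`, in which the formal variable `none`
records the order in `G` and the variables `some j` are the momenta `r_j`.
Second part: expansion as a formal power series in `r` alone. -/
theorem mainTheorem4 {d₁ d₂ d₃ : ℕ} {U : Set (Fin d₁ → ℝ)} {V : Set (Fin d₂ → ℝ)}
    (hU : IsOpen U) (hV : IsOpen V)
    (F : ThickMorphism.GeneratingFunction U d₂) (G : ThickMorphism.GeneratingFunction V d₃)
    (hφ : Set.MapsTo F.phi U V) (x : Fin d₁ → ℝ) (hx : x ∈ U) :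
    ThickMorphism.HasTreeExpansion F G
        (MvPowerSeries.X none : MvPowerSeries (Option (Fin d₃)) ℝ)
        (fun j => MvPowerSeries.X (some j)) x ∧
      (fderiv ℝ G.zeroth (F.phi x) = 0 → fderiv ℝ (fderiv ℝ G.zeroth) (F.phi x) = 0 →
        ThickMorphism.HasTreeExpansion F G
          (1 : MvPowerSeries (Fin d₃) ℝ) (fun j => MvPowerSeries.X j) x) := by
  have hG : ∀ ℓ a, ContDiffAt ℝ ∞ (G.coeff ℓ a) (F.phi x) := fun ℓ a =>
    (G.smooth ℓ a).contDiffAt (hV.mem_nhds (hφ hx))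
  refine ⟨ThickMorphism.hasTreeExpansion hG (fun j => ?_) (Or.inl ?_), fun h1 h2 =>
    ThickMorphism.hasTreeExpansion hG (fun j => ?_) (Or.inr ⟨h1, h2⟩)⟩ <;>
  exact ThickMorphism.mem_orderIdeal_one.2 (by simp)
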